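/- Let $\mathbb F$ be an algebraically closed field of characteristic $p\neq 2$. Put $\mathbb I=\mathbb Z_{\ge 0}$ if $p=0$ and $\mathbb I=\{0,1,\dots,\frac{p-1}{2}\}$ if $p\ge 3$, and $q(i)=i(i+1)\in\mathbb F$ for $i\in\mathbb I$. The affine Hecke–Clifford algebra $\mathfrak H^{\mathfrak c}_n$ is the $\mathbb F$-superalgebra with even generators $s_1,\dots,s_{n-1},x_1,\dots,x_n$ and odd generators $c_1,\dots,c_n$ subject to the relations $$s_i^2=1,\quad s_is_j=s_js_i\ (|i-j|>1),\quad s_is_{i+1}s_i=s_{i+1}s_is_{i+1},\quad x_ix_j=x_jx_i,\quad c_i^2=1,\quad c_ic_j=-c_jc_i\ (i\ne j),$$ $$s_ix_i=x_{i+1}s_i-(1+c_ic_{i+1}),\quad s_ix_j=x_js_i\ (j\neq i,i+1),\quad s_ic_i=c_{i+1}s_i,\quad s_ic_{i+1}=c_is_i,\quad s_ic_j=c_js_i\ (j\ne i,i+1),$$ $$x_ic_i=-c_ix_i,\quad x_ic_j=c_jx_i\ (i\neq j).$$ Modules are $\mathbb Z/2$-graded, and irreducible means nonzero with no graded submodules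 other than $0$ and the whole module. A finite-dimensional $\mathfrak H^{\mathfrak c}_n$-module $M$ is called integral if all eigenvalues of $x_1^2,\dots,x_n^2$ on $M$ are of the form $q(i)$ with $i\in\mathbb I$. A tuple $\underline i=(i_1,\dots,i_n)\in\mathbb I^n$ is a weight of $M$ if $M_{\underline i}=\{z\in M : (x_k^2-q(i_k))^Nz=0\text{ for }N\gg0,\ 1\le k\le n\}\neq 0$. Let $s_k\cdot\underline i$ denote $\underline i$ with the entries $i_k$ and $i_{k+1}$ interchanged. **Theorem.** Let $n\in\{2,3\}$ and let $M$ be an irreducible integral finite-dimensional $\mathfrak H^{\mathfrak c}_n$-module. Then $x_1^2,\dots,x_n^2$ all act semisimply on $M$ if and only if every weight $\underline i\in\mathbb I^n$ of $M$ satisfies the following: 1. for $1\le k\le n-1$, if $i_k\neq i_{k+1}\pm1$, then $s_k\cdot\underline i$ is a weight of $M$; 2. if $i_k=i_{k+1}$ for some $1\le k\le n-1$, then $i_k=i_{k+1}=0$; 3. there is no $1\le k\le n-2$ with $i_k=i_{k+1}=i_{k+2}$; 4. if $i_k=i_{k+2}$ for some $1\le k\le n-2$, then: (a) if $p=0$,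 then $i_k=i_{k+2}=0$; (b) if $p\ge 3$, then either $i_k=i_{k+2}=\frac{p-3}{2}$ and $i_{k+1}=\frac{p-1}{2}$, or $i_k=i_{k+2}=0$. -/

import Mathlib

noncomputable section

namespace AffineHeckeClifford

/-! ### The affine Hecke-Clifford superalgebra

Indices are shifted by one: the generators `x`, `c` are indexed by `0, …, n - 1` and the generators
`s` by those `k` with `k + 1 < n`. -/

/-- The generators of the affine Hecke-Clifford algebra of rank `n`. -/
inductive Gen (n : ℕ) : Type
  | s (k : ℕ) (h : k + 1 < n) : Gen n
  | x (k : Fin n) : Gen n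
  | c (k : Fin n) : Gen n

/-- The parity of a generator: the `s` and the `x` are even, the `c` are odd. -/
def Gen.parity {n : ℕ} : Gen n → ZMod 2
  | .s _ _ => 0
  | .x _ => 0
  | .c _ => 1

section Presentation

variable (F : Type*) [Field F]

/-- The generators `s` inside the free algebra. -/
abbrev preS {n : ℕ} (k : ℕ) (h : k + 1 < n) : FreeAlgebra F (Gen n) := FreeAlgebra.ι F (Gen.s k h)

/-- The generators `x` inside the free algebra. -/
abbrev preX {n : ℕ} (k : Fin n) : FreeAlgebra F (Gen n) := FreeAlgebra.ι F (Gen.x k)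

/-- The generators `c` inside the free algebra. -/
abbrev preC {n : ℕ} (k : Fin n) : FreeAlgebra F (Gen n) := FreeAlgebra.ι F (Gen.c k)

/-- The defining relations of the affine Hecke-Clifford algebra. -/
inductive Rel (n : ℕ) : FreeAlgebra F (Gen n) → FreeAlgebra F (Gen n) → Prop
  | s_sq (k : ℕ) (h : k + 1 < n) : Rel n (preS F k h * preS F k h) 1
  | s_comm (k l : ℕ) (hk : k + 1 < n) (hl : l + 1 < n) (hkl : k + 1 < l) :
      Rel n (preS F k hk * preS F l hl) (preS F l hl * preS F k hk)
  | braid (k : ℕ) (hk : k + 1 < n) (hk' : k + 1 + 1 < n) :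
      Rel n (preS F k hk * preS F (k + 1) hk' * preS F k hk)
        (preS F (k + 1) hk' * preS F k hk * preS F (k + 1) hk')
  | x_comm (k l : Fin n) : Rel n (preX F k * preX F l) (preX F l * preX F k)
  | c_sq (k : Fin n) : Rel n (preC F k * preC F k) 1
  | c_anticomm (k l : Fin n) (hkl : k ≠ l) : Rel n (preC F k * preC F l) (-(preC F l * preC F k))
  | s_x (k : ℕ) (h : k + 1 < n) :
      Rel n (preS F k h * preX F ⟨k, Nat.lt_of_succ_lt h⟩)
        (preX F ⟨k + 1, h⟩ * preS F k h
          - (1 + preC F ⟨k, Nat.lt_of_succ_lt h⟩ * preC F ⟨k + 1, h⟩))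
  | s_x_far (k : ℕ) (h : k + 1 < n) (l : Fin n) (hl : (l : ℕ) ≠ k) (hl' : (l : ℕ) ≠ k + 1) :
      Rel n (preS F k h * preX F l) (preX F l * preS F k h)
  | s_c (k : ℕ) (h : k + 1 < n) :
      Rel n (preS F k h * preC F ⟨k, Nat.lt_of_succ_lt h⟩) (preC F ⟨k + 1, h⟩ * preS F k h)
  | s_c_succ (k : ℕ) (h : k + 1 < n) :
      Rel n (preS F k h * preC F ⟨k + 1, h⟩) (preC F ⟨k, Nat.lt_of_succ_lt h⟩ * preS F k h)
  | s_c_far (k : ℕ) (h : k + 1 < n) (l : Fin n) (hl : (l : ℕ) ≠ k) (hl' : (l : ℕ) ≠ k + 1) :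
      Rel n (preS F k h * preC F l) (preC F l * preS F k h)
  | x_c (k : Fin n) : Rel n (preX F k * preC F k) (-(preC F k * preX F k))
  | x_c_far (k l : Fin n) (hkl : k ≠ l) : Rel n (preX F k * preC F l) (preC F l * preX F k)

end Presentation

/-- The affine Hecke-Clifford algebra of rank `n` over `F`. -/
abbrev AHC (F : Type*) [Field F] (n : ℕ) : Type _ := RingQuot (Rel F n)

section Algebra

variable (F : Type*) [Field F] (n : ℕ)

/-- The image of a generator in the affine Hecke-Clifford algebra. -/
def gen (g : Gen n) : AHC F n := RingQuot.mkAlgHom F (Rel F n) (FreeAlgebra.ι F g)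

/-- The `ℤ/2`-grading: the piece of degree `d` is spanned by the monomials in the generators whose
parities add up to `d`. -/
def grading (d : ZMod 2) : Submodule F (AHC F n) :=
  Submodule.span F {a | ∃ l : List (Gen n), (l.map Gen.parity).sum = d ∧ (l.map (gen F n)).prod = a}

variable {n} in
theorem gen_mem_grading (g : Gen n) : gen F n g ∈ grading F n g.parity :=
  Submodule.subset_span ⟨[g], by simp⟩

instance grading.gradedMonoid : SetLike.GradedMonoid (grading F n) where
  one_mem := Submodule.subset_span ⟨[], by simp⟩
  mul_mem := by
    intro i j a b ha hb
    refine Submodule.span_induction₂ (p := fun a b _ _ => a * b ∈ grading F n (i + j))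
      ?_ ?_ ?_ ?_ ?_ ?_ ?_ ha hb
    · rintro _ _ ⟨l, rfl, rfl⟩ ⟨m, rfl, rfl⟩
      exact Submodule.subset_span ⟨l ++ m, by simp⟩
    · intros; simp
    · intros; simp
    · intro x y z _ _ _ h1 h2; rw [add_mul]; exact add_mem h1 h2
    · intro x y z _ _ _ h1 h2; rw [mul_add]; exact add_mem h1 h2
    · intro r x y _ _ h; rw [smul_mul_assoc]; exact Submodule.smul_mem _ _ h
    · intro r x y _ _ h; rw [mul_smul_comm]; exact Submodule.smul_mem _ _ h

open DirectSum in
/-- Auxiliary to the grading: the algebra map out of the free algebra. -/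
def preDecompose : FreeAlgebra F (Gen n) →ₐ[F] ⨁ d, grading F n d :=
  FreeAlgebra.lift F fun g =>
    DirectSum.of (fun d => grading F n d) g.parity ⟨gen F n g, gen_mem_grading F g⟩

theorem coe_preDecompose (a : FreeAlgebra F (Gen n)) :
    DirectSum.coeAlgHom (grading F n) (preDecompose F n a) = RingQuot.mkAlgHom F (Rel F n) a := by
  have : (DirectSum.coeAlgHom (grading F n)).comp (preDecompose F n)
      = RingQuot.mkAlgHom F (Rel F n) := by
    ext g
    simp [preDecompose, gen]
  exact AlgHom.congr_fun this a

/-- Auxiliary to the grading: `a` is sent into the component of degree `d`. -/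
def IsPreHomogeneous (d : ZMod 2) (a : FreeAlgebra F (Gen n)) : Prop :=
  ∃ y, preDecompose F n a = DirectSum.of (fun d => grading F n d) d y

variable {F n}

theorem IsPreHomogeneous.ι (g : Gen n) : IsPreHomogeneous F n g.parity (FreeAlgebra.ι F g) :=
  ⟨⟨gen F n g, gen_mem_grading F g⟩, by simp [preDecompose]⟩

theorem IsPreHomogeneous.one : IsPreHomogeneous F n 0 1 := ⟨1, by simp [DirectSum.one_def]; rfl⟩

theorem IsPreHomogeneous.mul {d e f : ZMod 2} {a b : FreeAlgebra F (Gen n)}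
    (ha : IsPreHomogeneous F n d a) (hb : IsPreHomogeneous F n e b) (h : d + e = f) :
    IsPreHomogeneous F n f (a * b) := by
  obtain ⟨y, hy⟩ := ha
  obtain ⟨z, hz⟩ := hb
  subst h
  exact ⟨_, by rw [map_mul, hy, hz, DirectSum.of_mul_of]⟩

theorem IsPreHomogeneous.neg {d : ZMod 2} {a : FreeAlgebra F (Gen n)}
    (ha : IsPreHomogeneous F n d a) : IsPreHomogeneous F n d (-a) := by
  obtain ⟨y, hy⟩ := ha
  refine ⟨(-1 : F) • y, ?_⟩
  rw [← neg_one_smul F a, map_smul, hy, ← DirectSum.lof_eq_of F, ← map_smul]; rfl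

theorem IsPreHomogeneous.add {d : ZMod 2} {a b : FreeAlgebra F (Gen n)}
    (ha : IsPreHomogeneous F n d a) (hb : IsPreHomogeneous F n d b) :
    IsPreHomogeneous F n d (a + b) := by
  obtain ⟨y, hy⟩ := ha
  obtain ⟨z, hz⟩ := hb
  exact ⟨y + z, by rw [map_add, hy, hz, map_add]⟩

theorem Rel.homogeneous {a b : FreeAlgebra F (Gen n)} (h : Rel F n a b) :
    ∃ d, IsPreHomogeneous F n d a ∧ IsPreHomogeneous F n d b := by
  have hs : ∀ k h, IsPreHomogeneous F n 0 (preS F k h) := fun k h => .ι (Gen.s k h)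
  have hx : ∀ k, IsPreHomogeneous F n 0 (preX F k) := fun k => .ι (Gen.x k)
  have hc : ∀ k, IsPreHomogeneous F n 1 (preC F k) := fun k => .ι (Gen.c k)
  cases h with
  | s_sq k h => exact ⟨0, (hs _ _).mul (hs _ _) rfl, .one⟩
  | s_comm k l hk hl hkl => exact ⟨0, (hs _ _).mul (hs _ _) rfl, (hs _ _).mul (hs _ _) rfl⟩
  | braid k hk hk' =>
    exact ⟨0, ((hs _ _).mul (hs _ _) rfl).mul (hs _ _) rfl,
      ((hs _ _).mul (hs _ _) rfl).mul (hs _ _) rfl⟩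
  | x_comm k l => exact ⟨0, (hx _).mul (hx _) rfl, (hx _).mul (hx _) rfl⟩
  | c_sq k => exact ⟨0, (hc _).mul (hc _) rfl, .one⟩
  | c_anticomm k l hkl => exact ⟨0, (hc _).mul (hc _) rfl, ((hc _).mul (hc _) rfl).neg⟩
  | s_x k h =>
    refine ⟨0, (hs _ _).mul (hx _) rfl, ?_⟩
    rw [sub_eq_add_neg]
    exact ((hx _).mul (hs _ _) rfl).add (IsPreHomogeneous.one.add ((hc _).mul (hc _) rfl)).neg
  | s_x_far k h l hl hl' => exact ⟨0, (hs _ _).mul (hx _) rfl, (hx _).mul (hs _ _) rfl⟩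
  | s_c k h => exact ⟨1, (hs _ _).mul (hc _) rfl, (hc _).mul (hs _ _) rfl⟩
  | s_c_succ k h => exact ⟨1, (hs _ _).mul (hc _) rfl, (hc _).mul (hs _ _) rfl⟩
  | s_c_far k h l hl hl' => exact ⟨1, (hs _ _).mul (hc _) rfl, (hc _).mul (hs _ _) rfl⟩
  | x_c k => exact ⟨1, (hx _).mul (hc _) rfl, ((hc _).mul (hx _) rfl).neg⟩
  | x_c_far k l hkl => exact ⟨1, (hx _).mul (hc _) rfl, (hc _).mul (hx _) rfl⟩

theorem preDecompose_rel {a b : FreeAlgebra F (Gen n)} (h : Rel F n a b) :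
    preDecompose F n a = preDecompose F n b := by
  obtain ⟨d, ⟨y, hy⟩, ⟨z, hz⟩⟩ := h.homogeneous
  have h1 := coe_preDecompose F n a
  have h2 := coe_preDecompose F n b
  rw [RingQuot.mkAlgHom_rel F h, ← h2, hy, hz, DirectSum.coeAlgHom_of, DirectSum.coeAlgHom_of] at h1
  rw [hy, hz, Subtype.ext h1]

variable (F n)

/-- The affine Hecke-Clifford algebra is a superalgebra. -/
instance gradedAlgebra : GradedAlgebra (grading F n) :=
  GradedAlgebra.ofAlgHom (grading F n)
    (RingQuot.liftAlgHom F ⟨preDecompose F n, fun _ _ h => preDecompose_rel h⟩)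
    (by
      apply RingQuot.ringQuot_ext'
      ext g
      simp [preDecompose, gen])
    (by
      rintro d ⟨x, hx⟩
      induction hx using Submodule.span_induction with
      | mem x h =>
        obtain ⟨l, rfl, rfl⟩ := h
        induction l with
        | nil => simp [DirectSum.one_def]; rfl
        | cons g l ih =>
          simp only [List.map_cons, List.prod_cons, map_mul]
          rw [ih]
          simp only [gen, RingQuot.liftAlgHom_mkAlgHom_apply]
          simp only [preDecompose, FreeAlgebra.lift_ι_apply, DirectSum.of_mul_of]
          rfl
      | zero => rw [map_zero]; exact (map_zero _).symm
      | add x y hx hy h1 h2 => rw [map_add, h1, h2, ← map_add]; rfl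
      | smul r x hx h =>
        simp only at h ⊢
        rw [map_smul, h, ← DirectSum.lof_eq_of F, ← DirectSum.lof_eq_of F, ← map_smul]; rfl)

/-- The generator `x` with index `k`, as an element of the algebra. -/
def X (k : Fin n) : AHC F n := gen F n (Gen.x k)

end Algebra

/-! ### Integral modules, irreducibility and weights -/

/-- The index set of the weights in characteristic `p`: all natural numbers if `p = 0`, and
`{0, 1, …, (p - 1) / 2}` otherwise. -/
def indexSet (p : ℕ) : Set ℕ := if p = 0 then Set.univ else Set.Iic ((p - 1) / 2)

/-- `q i = i * (i + 1)`, as an element of the field. -/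
def q (F : Type*) [Field F] (i : ℕ) : F := (i : F) * ((i : F) + 1)

section Modules

variable (F : Type*) [Field F] (n : ℕ) (M : Type*) [AddCommGroup M] [Module F M]
  [Module (AHC F n) M]

/-- Irreducibility of a supermodule: it is nonzero and has no graded submodules besides the obvious
two. -/
def IsIrreducible (ℳ : ZMod 2 → Submodule F M) [DirectSum.Decomposition ℳ] : Prop :=
  Nontrivial M ∧ ∀ N : Submodule (AHC F n) M, N.IsHomogeneous ℳ → N = ⊥ ∨ N = ⊤

variable [IsScalarTower F (AHC F n) M]

/-- The action on `M` of the square of the generator `x` with index `k`. -/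
def xSq (k : Fin n) : Module.End F M := Algebra.lsmul F F M (X F n k ^ 2)

/-- Integrality: all eigenvalues of the squares of the generators `x` are of the form `q i` with `i`
in the index set. -/
def IsIntegral (p : ℕ) : Prop :=
  ∀ (k : Fin n) (μ : F), (xSq F n M k).HasEigenvalue μ → ∃ i ∈ indexSet p, μ = q F i

/-- The simultaneous generalized eigenspace of the squares of the generators `x` for the eigenvalues
`q (i k)`. -/
def weightSpace (i : Fin n → ℕ) : Submodule F M :=
  ⨅ k, (xSq F n M k).maxGenEigenspace (q F (i k))

/-- The set of weights of `M`. -/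
def weights (p : ℕ) : Set (Fin n → ℕ) :=
  {i | (∀ k, i k ∈ indexSet p) ∧ weightSpace F n M i ≠ ⊥}

end Modules

/-- The list of properties of a tuple `i` relative to a set `W` of tuples (the set of weights of a
module). -/
structure WeightConditions (p : ℕ) {n : ℕ} (W : Set (Fin n → ℕ)) (i : Fin n → ℕ) : Prop where
  /-- If `i k ≠ i (k + 1) ± 1`, then interchanging the entries `k`, `k + 1` gives an element
  of `W`. -/
  swap_mem : ∀ k l : Fin n, (l : ℕ) = k + 1 → i k ≠ i l + 1 → i l ≠ i k + 1 → i ∘ Equiv.swap k l ∈ W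
  /-- Equal neighbours are zero. -/
  eq_zero : ∀ k l : Fin n, (l : ℕ) = k + 1 → i k = i l → i k = 0 ∧ i l = 0
  /-- No three consecutive entries are equal. -/
  not_three : ¬ ∃ k l m : Fin n, (l : ℕ) = k + 1 ∧ (m : ℕ) = k + 2 ∧ i k = i l ∧ i l = i m
  /-- Equal entries at distance two, characteristic zero. -/
  char_zero : ∀ k m : Fin n, (m : ℕ) = k + 2 → i k = i m → p = 0 → i k = 0 ∧ i m = 0
  /-- Equal entries at distance two, positive characteristic. -/
  char_pos : ∀ k l m : Fin n, (l : ℕ) = k + 1 → (m : ℕ) = k + 2 → i k = i m → 3 ≤ p →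
    (i k = (p - 3) / 2 ∧ i m = (p - 3) / 2 ∧ i l = (p - 1) / 2) ∨ (i k = 0 ∧ i m = 0)

end AffineHeckeClifford

end

/-! ### Two strands

Identities between the operators of one transposition and of the two strands it involves. -/

namespace AffineHeckeClifford

/-! Everything rests on the intertwiner Φ_k = s_k(x_k² - x_{k+1}²) + T_k, where T_k = x_k + x_{k+1}
+ c_k c_{k+1}(x_k - x_{k+1}) is the `tail`. It permutes the x and c by the transposition, hence
moves simultaneous eigenvectors of the x² from a weight i to s_k·i. On an eigenvector with
eigenvalues A, B of x_k², x_{k+1}² one has Φ_k = (A - B)s_k + T_k, T_k² = 2(A + B) and Φ_k² = 2(A +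
B) - (A - B)².

Suppose the x² are semisimple, so that every weight has an honest eigenvector z. If Φ_k² is a
nonzero scalar, s_k·i is a weight (`swap_mem_weights`). If i_k = i_{k+1}, a Jordan block is avoided
only if T_k z = 0 (`opTail_eq_zero`), and T_k² = 4A then forces A = 0. Three equal entries would
make two Clifford generators agree on z (`not_three_eq`). If i_k = i_{k+2} ≠ 0, both interchanges
are forbidden, so s_k and s_{k+1} act as opposite multiples of tails; the braid relation leaves only
A + 3B = 0 (`q_add_three_mul_q_eq_zero`), which is the exceptional case in characteristic p.

For the converse, consider the eigenvectors killed by the tail of each pair of zero entries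
(`IsGood`). Conditions 2 and 3, with n ≤ 3, make their span a submodule: s_k is recovered from Φ_k
and T_k at distinct entries, and preserves eigenvalues at two zeros. The span is graded and nonzero,
so irreducibility makes it all of M, and the x² are diagonalisable. -/

/-- Operators `X, Y, C, D` on a vector space that satisfy the relations between the generators `x`
and `c` of two strands. -/
structure StrandPair {F M : Type*} [Field F] [AddCommGroup M] [Module F M]
    (X Y C D : M →ₗ[F] M) : Prop where
  yx : ∀ z, Y (X z) = X (Y z)
  cc : ∀ z, C (C z) = z
  dd : ∀ z, D (D z) = z
  dc : ∀ z, D (C z) = -C (D z)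
  xc : ∀ z, X (C z) = -C (X z)
  yd : ∀ z, Y (D z) = -D (Y z)
  xd : ∀ z, X (D z) = D (X z)
  yc : ∀ z, Y (C z) = C (Y z)

/-- Operators `S, X, Y, C, D` on a vector space that satisfy the defining relations of the affine
Hecke-Clifford algebra of rank two. -/
structure TwoStrand {F M : Type*} [Field F] [AddCommGroup M] [Module F M]
    (S X Y C D : M →ₗ[F] M) : Prop extends StrandPair X Y C D where
  ss : ∀ z, S (S z) = z
  sx : ∀ z, S (X z) = Y (S z) - z - C (D z)
  sc : ∀ z, S (C z) = D (S z)
  sd : ∀ z, S (D z) = C (S z)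

/-- The part of the intertwiner that does not involve the transposition. -/
def tail {F M : Type*} [Field F] [AddCommGroup M] [Module F M]
    (X Y C D : M →ₗ[F] M) : M →ₗ[F] M :=
  X + Y + C ∘ₗ D ∘ₗ (X - Y)

/-- The intertwiner. -/
def intertwiner {F M : Type*} [Field F] [AddCommGroup M] [Module F M]
    (S X Y C D : M →ₗ[F] M) : M →ₗ[F] M :=
  S ∘ₗ (X ∘ₗ X - Y ∘ₗ Y) + tail X Y C D

namespace StrandPair

variable {F M : Type*} [Field F] [AddCommGroup M] [Module F M] {X Y C D : M →ₗ[F] M}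

theorem tail_apply (z : M) : tail X Y C D z = X z + Y z + C (D (X z)) - C (D (Y z)) := by
  simp [tail, add_sub_assoc]

/-- Since `CD` squares to -1 and anticommutes with `X` and `Y`, the mixed terms cancel and (X + Y)²
+ (X - Y)² remains. -/
theorem tail_tail (h : StrandPair X Y C D) {z : M} {A B : F} (hx : X (X z) = A • z)
    (hy : Y (Y z) = B • z) : tail X Y C D (tail X Y C D z) = (2 * (A + B)) • z := by
  simp only [tail_apply, map_sub, map_add, h.xd, h.xc, map_neg,
    h.yd, h.yc, h.yx, h.dc, h.cc, h.dd, hx, hy, map_smul]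
  module

/-- The kernel of the tail. -/
theorem tail_eq_zero_iff (h : StrandPair X Y C D) (h2 : (2 : F) ≠ 0) (z : M) :
    tail X Y C D z = 0 ↔ X z = C (D (Y z)) := by
  constructor
  · intro hz
    -- The tail is (1 + CD)X + (1 - CD)Y; multiplying by 1 - CD, with (CD)² = -1, gives 2X - 2CDY.
    have h1 : tail X Y C D z - C (D (tail X Y C D z)) = 0 := by simp [hz]
    simp only [tail_apply, map_sub, map_add, h.dc, map_neg, h.cc, h.dd] at h1
    rw [← sub_eq_zero]
    refine (smul_eq_zero_iff_right h2).1 ?_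
    rw [← h1]
    module
  · intro hz
    simp only [tail_apply, hz, map_neg, h.dc, h.cc, h.dd]
    module

/-- The failure of the braid relation for the tails. -/
theorem tail_braid {Z E : M →ₗ[F] M} (h : StrandPair X Y C D) (h' : StrandPair Y Z D E)
    (h'' : StrandPair X Z C E) {z : M} {A B : F} (hx : X (X z) = A • z) (hy : Y (Y z) = B • z)
    (hz : Z (Z z) = A • z) :
    tail X Y C D (tail Y Z D E (tail X Y C D z)) + tail Y Z D E (tail X Y C D (tail Y Z D E z)) =
      (2 * (A + 3 * B)) • tail X Z C E z := by
  have hx1 : X (X (Y z)) = A • Y z := by rw [← h.yx, ← h.yx, hx, map_smul]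
  have hx2 : X (X (Z z)) = A • Z z := by rw [← h''.yx, ← h''.yx, hx, map_smul]
  have hy2 : Y (Y (Z z)) = B • Z z := by rw [← h'.yx, ← h'.yx, hy, map_smul]
  simp only [tail_apply, map_sub, map_add, h.xd, h.xc, map_neg, h.yd, h.yc, h.yx, h.dc, h.cc, h.dd,
    h'.xd, h'.yd, h'.yc, h'.yx, h'.dc, h'.dd, h''.xd, h''.yc, h''.yx, h''.dc, hy, hz,
    hx1, hx2, hy2, map_smul]
  module

end StrandPair

namespace TwoStrand

open StrandPair

variable {F M : Type*} [Field F] [AddCommGroup M] [Module F M] {S X Y C D : M →ₗ[F] M}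

theorem intertwiner_apply (z : M) :
    intertwiner S X Y C D z = S (X (X z)) - S (Y (Y z)) + tail X Y C D z := by
  simp [intertwiner]

theorem sy (h : TwoStrand S X Y C D) (z : M) : S (Y z) = X (S z) + z - C (D z) := by
  have h1 := congrArg S (h.sx (S z))
  simp only [map_sub, h.ss, h.sc, h.sd, h.dc] at h1
  linear_combination (norm := module) (-1 : F) • h1

/-- The tail is exactly the correction met when `S` passes a square. Hence `S` respects equal
eigenvalues on vectors that the tail kills. -/
theorem s_xx (h : TwoStrand S X Y C D) (z : M) :
    S (X (X z)) = Y (Y (S z)) - tail X Y C D z := by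
  simp only [tail_apply, h.sx, map_sub, h.yd, h.yc, map_neg]
  module

theorem s_yy (h : TwoStrand S X Y C D) (z : M) :
    S (Y (Y z)) = X (X (S z)) + tail X Y C D z := by
  simp only [tail_apply, h.sy, map_sub, map_add, h.xd, h.xc]
  module

theorem intertwiner_x (h : TwoStrand S X Y C D) (z : M) :
    intertwiner S X Y C D (X z) = Y (intertwiner S X Y C D z) := by
  simp only [intertwiner_apply, tail_apply, h.sx, h.sy, map_sub, map_add, h.xd, h.xc, map_neg,
    h.yd, h.yc, h.yx]
  module

theorem intertwiner_y (h : TwoStrand S X Y C D) (z : M) :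
    intertwiner S X Y C D (Y z) = X (intertwiner S X Y C D z) := by
  simp only [intertwiner_apply, tail_apply, h.sx, h.sy, map_sub, map_add, h.xd, h.xc, map_neg,
    h.yd, h.yc, h.yx]
  module

theorem intertwiner_c (h : TwoStrand S X Y C D) (z : M) :
    intertwiner S X Y C D (C z) = D (intertwiner S X Y C D z) := by
  simp only [intertwiner_apply, tail_apply, h.sx, h.sy, h.sc, map_sub, map_add, h.xd, h.xc, map_neg,
    h.yd, h.yc, h.dc, h.cc, h.dd]
  module

theorem intertwiner_d (h : TwoStrand S X Y C D) (z : M) :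
    intertwiner S X Y C D (D z) = C (intertwiner S X Y C D z) := by
  simp only [intertwiner_apply, tail_apply, h.sx, h.sy, h.sd, map_sub, map_add, h.xd, h.xc, map_neg,
    h.yd, h.yc, h.cc, h.dd]
  module

theorem intertwiner_of_eigen {z : M} {A B : F} (hx : X (X z) = A • z) (hy : Y (Y z) = B • z) :
    intertwiner S X Y C D z = (A - B) • S z + tail X Y C D z := by
  rw [intertwiner_apply, hx, hy, map_smul, map_smul, sub_smul]

/-- The first application exchanges `A` and `B`, so the two transpositions contribute -(A - B)² and
the two tails 2(A + B). The mixed terms cancel because `S` commutes with the tail. -/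
theorem intertwiner_intertwiner (h : TwoStrand S X Y C D) {z : M} {A B : F}
    (hx : X (X z) = A • z) (hy : Y (Y z) = B • z) :
    intertwiner S X Y C D (intertwiner S X Y C D z) = (2 * (A + B) - (A - B) ^ 2) • z := by
  have hx' : X (X (intertwiner S X Y C D z)) = B • intertwiner S X Y C D z := by
    rw [← h.intertwiner_y, ← h.intertwiner_y, hy, map_smul]
  have hy' : Y (Y (intertwiner S X Y C D z)) = A • intertwiner S X Y C D z := by
    rw [← h.intertwiner_x, ← h.intertwiner_x, hx, map_smul]
  rw [intertwiner_of_eigen hx' hy', intertwiner_of_eigen hx hy, map_add, map_add, map_smul,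
    map_smul, h.tail_tail hx hy, h.ss]
  simp only [tail_apply, h.sx, h.sy, h.sd, h.sc, map_sub, map_add,
    h.dc, h.cc, h.dd]
  module

/-- The transposition preserves the kernel of the tail. -/
theorem x_s_of_tail (h : TwoStrand S X Y C D) {z : M} (hz : X z = C (D (Y z))) :
    X (S z) = C (D (Y (S z))) := by
  have h1 : X (S z) = S (Y z) - z + C (D z) := by rw [h.sy]; module
  have h2 : Y (S z) = S (X z) + z + C (D z) := by rw [h.sx]; module
  rw [h1, h2, hz]
  simp only [map_add, h.sc, h.sd, h.dc, h.cc, h.dd, map_neg]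
  module

end TwoStrand

end AffineHeckeClifford

namespace AffineHeckeClifford

/-! ### The operators of the generators -/

section Operators

variable {F : Type*} [Field F] {n : ℕ} {M : Type*} [AddCommGroup M] [Module F M]
  [Module (AHC F n) M] [IsScalarTower F (AHC F n) M]

variable (F M) in
/-- The action of a generator. -/
def opGen (g : Gen n) : M →ₗ[F] M := Algebra.lsmul F F M (gen F n g)

variable (F M) in
/-- The action of a generator `s`. -/
def opS (k : ℕ) (h : k + 1 < n) : M →ₗ[F] M := opGen F M (Gen.s k h)

variable (F M) in
/-- The action of a generator `x`. -/
def opX (k : Fin n) : M →ₗ[F] M := opGen F M (Gen.x k)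

variable (F M) in
/-- The action of a generator `c`. -/
def opC (k : Fin n) : M →ₗ[F] M := opGen F M (Gen.c k)

theorem opS_apply (k : ℕ) (h : k + 1 < n) (z : M) : opS F M k h z = gen F n (Gen.s k h) • z := rfl

theorem opX_apply (k : Fin n) (z : M) : opX F M k z = gen F n (Gen.x k) • z := rfl

theorem opC_apply (k : Fin n) (z : M) : opC F M k z = gen F n (Gen.c k) • z := rfl

theorem mk_preS (k : ℕ) (h : k + 1 < n) :
    RingQuot.mkAlgHom F (Rel F n) (preS F k h) = gen F n (Gen.s k h) := rfl

theorem mk_preX (k : Fin n) : RingQuot.mkAlgHom F (Rel F n) (preX F k) = gen F n (Gen.x k) := rfl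

theorem mk_preC (k : Fin n) : RingQuot.mkAlgHom F (Rel F n) (preC F k) = gen F n (Gen.c k) := rfl

/-- A defining relation, applied to a vector. -/
theorem Rel.smul_eq {F : Type*} [Field F] {n : ℕ} {M : Type*} [AddCommGroup M]
    [Module (AHC F n) M] {a b : FreeAlgebra F (Gen n)} (h : Rel F n a b) (z : M) :
    RingQuot.mkAlgHom F (Rel F n) a • z = RingQuot.mkAlgHom F (Rel F n) b • z := by
  rw [RingQuot.mkAlgHom_rel F h]

theorem xSq_apply (k : Fin n) (z : M) : xSq F n M k z = opX F M k (opX F M k z) := by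
  change (X F n k ^ 2) • z = X F n k • X F n k • z
  rw [pow_two, mul_smul]

theorem opS_opS (k : ℕ) (h : k + 1 < n) (z : M) : opS F M k h (opS F M k h z) = z := by
  simpa [mk_preS, opS_apply, mul_smul] using (Rel.s_sq k h).smul_eq z

theorem opS_braid (k : ℕ) (h : k + 1 < n) (h' : k + 1 + 1 < n) (z : M) :
    opS F M k h (opS F M (k + 1) h' (opS F M k h z)) =
      opS F M (k + 1) h' (opS F M k h (opS F M (k + 1) h' z)) := by
  simpa [mk_preS, opS_apply, mul_smul] using (Rel.braid k h h').smul_eq z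

theorem opX_comm (k l : Fin n) (z : M) : opX F M k (opX F M l z) = opX F M l (opX F M k z) := by
  simpa [mk_preX, opX_apply, mul_smul] using (Rel.x_comm k l).smul_eq z

theorem opC_opC (k : Fin n) (z : M) : opC F M k (opC F M k z) = z := by
  simpa [mk_preC, opC_apply, mul_smul] using (Rel.c_sq k).smul_eq z

theorem opC_anticomm {k l : Fin n} (h : k ≠ l) (z : M) :
    opC F M k (opC F M l z) = -opC F M l (opC F M k z) := by
  simpa [mk_preC, opC_apply, mul_smul] using (Rel.c_anticomm k l h).smul_eq z

theorem opX_opC_self (k : Fin n) (z : M) : opX F M k (opC F M k z) = -opC F M k (opX F M k z) := by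
  simpa [mk_preC, mk_preX, opC_apply, opX_apply, mul_smul] using (Rel.x_c k).smul_eq z

theorem opX_opC {k l : Fin n} (h : k ≠ l) (z : M) :
    opX F M k (opC F M l z) = opC F M l (opX F M k z) := by
  simpa [mk_preC, mk_preX, opC_apply, opX_apply, mul_smul] using (Rel.x_c_far k l h).smul_eq z

theorem opS_opX (k : ℕ) (h : k + 1 < n) (l : Fin n) (hl : (l : ℕ) ≠ k) (hl' : (l : ℕ) ≠ k + 1)
    (z : M) : opS F M k h (opX F M l z) = opX F M l (opS F M k h z) := by
  simpa [mk_preS, mk_preX, opS_apply, opX_apply, mul_smul] using (Rel.s_x_far k h l hl hl').smul_eq z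

theorem opS_opC (k : ℕ) (h : k + 1 < n) (l : Fin n) (hl : (l : ℕ) ≠ k) (hl' : (l : ℕ) ≠ k + 1)
    (z : M) : opS F M k h (opC F M l z) = opC F M l (opS F M k h z) := by
  simpa [mk_preS, mk_preC, opS_apply, opC_apply, mul_smul] using (Rel.s_c_far k h l hl hl').smul_eq z

theorem twoStrand (k : ℕ) (h : k + 1 < n) :
    TwoStrand (opS F M k h) (opX F M ⟨k, Nat.lt_of_succ_lt h⟩) (opX F M ⟨k + 1, h⟩)
      (opC F M ⟨k, Nat.lt_of_succ_lt h⟩) (opC F M ⟨k + 1, h⟩) where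
  ss := opS_opS k h
  sx z := by
    have := (Rel.s_x (F := F) k h).smul_eq z
    simp only [mk_preS, mk_preX, mk_preC, map_mul, map_sub, map_one, mul_smul, sub_smul,
      one_smul, ← sub_sub] at this
    exact this
  sc z := by simpa [mk_preS, mk_preC, opS_apply, opC_apply, mul_smul] using (Rel.s_c k h).smul_eq z
  sd z := by simpa [mk_preS, mk_preC, opS_apply, opC_apply, mul_smul] using (Rel.s_c_succ k h).smul_eq z
  yx := opX_comm _ _
  cc := opC_opC _
  dd := opC_opC _
  dc := opC_anticomm (by simp)
  xc := opX_opC_self _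
  yd := opX_opC_self _
  xd := opX_opC (by simp)
  yc := opX_opC (by simp)

/-- A subspace preserved by the generators is a submodule. -/
theorem smul_mem_of_generators (P : Submodule F M)
    (hP : ∀ g : Gen n, ∀ z ∈ P, opGen F M g z ∈ P) (a : AHC F n) : ∀ z ∈ P, a • z ∈ P := by
  obtain ⟨a, rfl⟩ := RingQuot.mkAlgHom_surjective F (Rel F n) a
  induction a using FreeAlgebra.induction with
  | grade0 r =>
    intro z hz
    rw [AlgHom.commutes, algebraMap_smul]
    exact P.smul_mem r hz
  | grade1 g => exact hP g
  | mul a b ha hb =>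
    intro z hz
    rw [map_mul, mul_smul]
    exact ha _ (hb _ hz)
  | add a b ha hb =>
    intro z hz
    rw [map_add, add_smul]
    exact P.add_mem (ha _ hz) (hb _ hz)

end Operators

/-! ### Simultaneous eigenvectors -/

section Eigenvectors

variable {F : Type*} [Field F] {n : ℕ} {M : Type*} [AddCommGroup M] [Module F M]
  [Module (AHC F n) M] [IsScalarTower F (AHC F n) M]

/-- `z` is a simultaneous eigenvector of the squares of the `x`, for the eigenvalues `q (i k)`,
or zero. -/
def IsEigen (i : Fin n → ℕ) (z : M) : Prop :=
  ∀ k, opX F M k (opX F M k z) = q F (i k) • z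

variable {i : Fin n → ℕ} {z w : M}

theorem isEigen_iff_forall_mem :
    IsEigen (F := F) i z ↔ ∀ k, z ∈ (xSq F n M k).eigenspace (q F (i k)) := by
  simp only [Module.End.mem_eigenspace_iff, xSq_apply, IsEigen]

theorem IsEigen.mem_weightSpace (h : IsEigen (F := F) i z) : z ∈ weightSpace F n M i := by
  rw [weightSpace, Submodule.mem_iInf]
  exact fun k => ((xSq F n M k).genEigenspace (q F (i k))).mono (le_top (a := (1 : ℕ∞)))
    (isEigen_iff_forall_mem.1 h k)

theorem IsEigen.mem_weights {p : ℕ} (h : IsEigen (F := F) i z) (hz : z ≠ 0)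
    (hi : ∀ k, i k ∈ indexSet p) : i ∈ weights F n M p :=
  ⟨hi, fun h0 => hz (by simpa [h0] using h.mem_weightSpace)⟩

theorem IsEigen.add (hz : IsEigen (F := F) i z) (hw : IsEigen (F := F) i w) :
    IsEigen (F := F) i (z + w) := by
  intro k; rw [map_add, map_add, hz, hw, smul_add]

theorem IsEigen.neg (hz : IsEigen (F := F) i z) : IsEigen (F := F) i (-z) := by
  intro k; rw [map_neg, map_neg, hz, smul_neg]

theorem IsEigen.sub (hz : IsEigen (F := F) i z) (hw : IsEigen (F := F) i w) :
    IsEigen (F := F) i (z - w) := by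
  rw [sub_eq_add_neg]; exact hz.add hw.neg

theorem IsEigen.opX (hz : IsEigen (F := F) i z) (j : Fin n) :
    IsEigen (F := F) i (opX F M j z) := by
  intro k
  rw [opX_comm k j, opX_comm k j, hz, map_smul]

theorem IsEigen.opC (hz : IsEigen (F := F) i z) (j : Fin n) :
    IsEigen (F := F) i (opC F M j z) := by
  intro k
  by_cases h : k = j
  · subst h
    rw [opX_opC_self, map_neg, opX_opC_self, neg_neg, hz, map_smul]
  · rw [opX_opC h, opX_opC h, hz, map_smul]

variable (F M) in
/-- The tail for the strands `k`, `k + 1`. -/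
abbrev opTail (k : ℕ) (h : k + 1 < n) : M →ₗ[F] M :=
  tail (opX F M ⟨k, Nat.lt_of_succ_lt h⟩) (opX F M ⟨k + 1, h⟩)
    (opC F M ⟨k, Nat.lt_of_succ_lt h⟩) (opC F M ⟨k + 1, h⟩)

variable (F M) in
/-- The intertwiner for the strands `k`, `k + 1`. -/
abbrev opPhi (k : ℕ) (h : k + 1 < n) : M →ₗ[F] M :=
  intertwiner (opS F M k h) (opX F M ⟨k, Nat.lt_of_succ_lt h⟩) (opX F M ⟨k + 1, h⟩)
    (opC F M ⟨k, Nat.lt_of_succ_lt h⟩) (opC F M ⟨k + 1, h⟩)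

theorem IsEigen.opTail (hz : IsEigen (F := F) i z) (k : ℕ) (h : k + 1 < n) :
    IsEigen (F := F) i (opTail F M k h z) := by
  rw [StrandPair.tail_apply]
  exact (((hz.opX _).add (hz.opX _)).add (((hz.opX _).opC _).opC _)).sub
    (((hz.opX _).opC _).opC _)

theorem opPhi_opX (k : ℕ) (h : k + 1 < n) (j : Fin n) (z : M) :
    opPhi F M k h (opX F M j z) =
      opX F M (Equiv.swap ⟨k, Nat.lt_of_succ_lt h⟩ ⟨k + 1, h⟩ j) (opPhi F M k h z) := by
  by_cases h1 : j = ⟨k, Nat.lt_of_succ_lt h⟩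
  · subst h1
    rw [Equiv.swap_apply_left]
    exact (twoStrand k h).intertwiner_x z
  by_cases h2 : j = ⟨k + 1, h⟩
  · subst h2
    rw [Equiv.swap_apply_right]
    exact (twoStrand k h).intertwiner_y z
  rw [Equiv.swap_apply_of_ne_of_ne h1 h2]
  have h3 := opS_opX (F := F) (n := n) (M := M) k h j (fun h3 => h1 (Fin.ext h3)) (fun h3 => h2 (Fin.ext h3))
  simp only [TwoStrand.intertwiner_apply, StrandPair.tail_apply, map_add, map_sub, ← h3,
    opX_comm _ j, opX_opC h1, opX_opC h2]

theorem opPhi_opC (k : ℕ) (h : k + 1 < n) (j : Fin n) (z : M) :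
    opPhi F M k h (opC F M j z) =
      opC F M (Equiv.swap ⟨k, Nat.lt_of_succ_lt h⟩ ⟨k + 1, h⟩ j) (opPhi F M k h z) := by
  by_cases h1 : j = ⟨k, Nat.lt_of_succ_lt h⟩
  · subst h1
    rw [Equiv.swap_apply_left]
    exact (twoStrand k h).intertwiner_c z
  by_cases h2 : j = ⟨k + 1, h⟩
  · subst h2
    rw [Equiv.swap_apply_right]
    exact (twoStrand k h).intertwiner_d z
  rw [Equiv.swap_apply_of_ne_of_ne h1 h2]
  have h3 := opS_opC (F := F) (M := M) k h j (fun h3 => h1 (Fin.ext h3)) (fun h3 => h2 (Fin.ext h3))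
  simp only [TwoStrand.intertwiner_apply, StrandPair.tail_apply, map_add, map_sub, ← h3,
    opX_opC (Ne.symm h1), opX_opC (Ne.symm h2), opC_anticomm h1, opC_anticomm h2, map_neg, neg_neg]

theorem IsEigen.opPhi (hz : IsEigen (F := F) i z) (k : ℕ) (h : k + 1 < n) :
    IsEigen (F := F) (i ∘ Equiv.swap ⟨k, Nat.lt_of_succ_lt h⟩ ⟨k + 1, h⟩) (opPhi F M k h z) := by
  intro j
  have := congrArg (fun z => AffineHeckeClifford.opPhi F M k h z)
    (hz (Equiv.swap ⟨k, Nat.lt_of_succ_lt h⟩ ⟨k + 1, h⟩ j))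
  rwa [opPhi_opX, opPhi_opX, Equiv.swap_apply_self, map_smul] at this

/-- Equal neighbours: if the tail kills a simultaneous eigenvector, then the transposition preserves
the eigenvalues. -/
theorem IsEigen.opS (hz : IsEigen (F := F) i z) (k : ℕ) (h : k + 1 < n)
    (hk : i ⟨k, Nat.lt_of_succ_lt h⟩ = i ⟨k + 1, h⟩) 
    (ht : AffineHeckeClifford.opTail F M k h z = 0) :
    IsEigen (F := F) i (opS F M k h z) := by
  intro j
  by_cases h1 : j = ⟨k, Nat.lt_of_succ_lt h⟩
  · subst h1
    have := (twoStrand (F := F) k h).s_yy z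
    rw [ht, add_zero, hz, map_smul, ← hk] at this
    exact this.symm
  by_cases h2 : j = ⟨k + 1, h⟩
  · subst h2
    have := (twoStrand (F := F) k h).s_xx z
    rw [ht, sub_zero, hz, map_smul, hk] at this
    exact this.symm
  have h3 := opS_opX (F := F) (n := n) (M := M) k h j (fun h3 => h1 (Fin.ext h3)) (fun h3 => h2 (Fin.ext h3))
  rw [← h3, ← h3, hz, map_smul]

end Eigenvectors

/-! ### The eigenvalues -/

section Eigenvalues

variable {F : Type*} [Field F] {p : ℕ}

theorem two_ne_zero_of_charP [CharP F p] (hp : p ≠ 2) : (2 : F) ≠ 0 := by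
  intro h
  have h1 : ((2 : ℕ) : F) = 0 := by exact_mod_cast h
  rw [CharP.cast_eq_zero_iff F p] at h1
  rcases (Nat.dvd_prime Nat.prime_two).1 h1 with h1 | h1
  · exact CharP.char_ne_one F p h1
  · exact hp h1

/-- In the range of the index set, a natural number vanishes in the field only if it is zero or
the characteristic. -/
theorem eq_zero_or_eq_of_cast_eq_zero [CharP F p] {m : ℕ} (hm : (m : F) = 0)
    (hle : p ≠ 0 → m ≤ p) : m = 0 ∨ (p ≠ 0 ∧ m = p) := by
  rw [CharP.cast_eq_zero_iff F p] at hm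
  by_cases h0 : p = 0
  · subst h0; left; simpa using hm
  · rcases Nat.eq_zero_or_pos m with h | h
    · exact Or.inl h
    · exact Or.inr ⟨h0, le_antisymm (hle h0) (Nat.le_of_dvd h hm)⟩

theorem odd_of_charP [CharP F p] (hp : p ≠ 2) : p = 0 ∨ (3 ≤ p ∧ p % 2 = 1) := by
  rcases CharP.char_is_prime_or_zero F p with h | h
  · right
    have := h.two_le
    rcases h.eq_two_or_odd with h | h <;> omega
  · exact Or.inl h

theorem le_of_mem_indexSet {i : ℕ} (h0 : p ≠ 0) (hi : i ∈ indexSet p) : i ≤ (p - 1) / 2 := by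
  simpa [indexSet, h0] using hi

theorem eq_zero_of_q_eq_zero [CharP F p] (hp : p ≠ 2) {i : ℕ} (hi : i ∈ indexSet p)
    (h : q F i = 0) : i = 0 := by
  have hodd := odd_of_charP (F := F) hp
  have hle := fun h0 : p ≠ 0 => le_of_mem_indexSet h0 hi
  rcases mul_eq_zero.1 h with h | h
  · have := eq_zero_or_eq_of_cast_eq_zero (F := F) (p := p) h (by omega)
    omega
  · have := eq_zero_or_eq_of_cast_eq_zero (F := F) (p := p) (m := i + 1) (by push_cast; exact h) (by omega)
    omega

/-- The difference of values is (i - j)(i + j + 1), and i + j + 1 ≤ p with equality only for i = j =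
(p - 1)/2. -/
theorem q_injOn [CharP F p] (hp : p ≠ 2) : Set.InjOn (q F) (indexSet p) := by
  intro i hi j hj h
  have hodd := odd_of_charP (F := F) hp
  have hle := fun h0 : p ≠ 0 => le_of_mem_indexSet h0 hi
  have hle' := fun h0 : p ≠ 0 => le_of_mem_indexSet h0 hj
  have h1 : ((i : F) - j) * (((i + j + 1 : ℕ) : F)) = 0 := by
    simp only [q] at h
    push_cast
    linear_combination h
  rcases mul_eq_zero.1 h1 with h1 | h1
  · rcases le_total j i with hij | hij
    · have := eq_zero_or_eq_of_cast_eq_zero (F := F) (p := p) (m := i - j) (by rw [Nat.cast_sub hij]; exact h1)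
        (by omega)
      omega
    · have := eq_zero_or_eq_of_cast_eq_zero (F := F) (p := p) (m := j - i)
        (by rw [Nat.cast_sub hij]; linear_combination -h1) (by omega)
      omega
  · have := eq_zero_or_eq_of_cast_eq_zero (F := F) (p := p) h1 (by omega)
    omega

/-- The scalar by which the square of the intertwiner acts vanishes only for neighbouring
entries. -/
theorem intertwiner_scalar_ne_zero [CharP F p] (hp : p ≠ 2) {i j : ℕ} (hi : i ∈ indexSet p)
    (hj : j ∈ indexSet p) (hij : i ≠ j) (h1 : i ≠ j + 1) (h2 : j ≠ i + 1) :
    2 * (q F i + q F j) - (q F i - q F j) ^ 2 ≠ 0 := by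
  intro h
  have hodd := odd_of_charP (F := F) hp
  have hle := fun h0 : p ≠ 0 => le_of_mem_indexSet h0 hi
  have hle' := fun h0 : p ≠ 0 => le_of_mem_indexSet h0 hj
  -- With u = i - j and v = i + j + 1 the scalar is -(u² - 1)(v² - 1).
  have h3 : ((i : F) - j - 1) * ((i : F) - j + 1) * (((i + j : ℕ) : F) * ((i + j + 2 : ℕ) : F)) = 0 := by
    simp only [q] at h
    push_cast
    linear_combination -h
  rcases mul_eq_zero.1 h3 with h3 | h3
  · rcases mul_eq_zero.1 h3 with h3 | h3
    · rcases le_total (j + 1) i with hij | hij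
      · have := eq_zero_or_eq_of_cast_eq_zero (F := F) (p := p) (m := i - (j + 1))
          (by rw [Nat.cast_sub hij]; push_cast; linear_combination h3) (by omega)
        omega
      · have := eq_zero_or_eq_of_cast_eq_zero (F := F) (p := p) (m := j + 1 - i)
          (by rw [Nat.cast_sub hij]; push_cast; linear_combination -h3) (by omega)
        omega
    · rcases le_total (i + 1) j with hij | hij
      · have := eq_zero_or_eq_of_cast_eq_zero (F := F) (p := p) (m := j - (i + 1))
          (by rw [Nat.cast_sub hij]; push_cast; linear_combination -h3) (by omega)
        omega
      · have := eq_zero_or_eq_of_cast_eq_zero (F := F) (p := p) (m := i + 1 - j)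
          (by rw [Nat.cast_sub hij]; push_cast; linear_combination h3) (by omega)
        omega
  · rcases mul_eq_zero.1 h3 with h3 | h3
    · have := eq_zero_or_eq_of_cast_eq_zero (F := F) (p := p) h3 (by omega)
      omega
    -- As i ≠ j, i + j + 2 = p only for the two largest indices, which are neighbours.
    · have := eq_zero_or_eq_of_cast_eq_zero (F := F) (p := p) h3 (by omega)
      omega

/-- Solutions of `q i + 3 * q j = 0` with `i`, `j` neighbours. -/
theorem eq_of_q_add_three_mul_q [CharP F p] (hp : p ≠ 2) {i j : ℕ} (hi : i ∈ indexSet p)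
    (hj : j ∈ indexSet p) (hij : i = j + 1 ∨ j = i + 1) (h : q F i + 3 * q F j = 0) :
    3 ≤ p ∧ i = (p - 3) / 2 ∧ j = (p - 1) / 2 := by
  have hodd := odd_of_charP (F := F) hp
  have hle := fun h0 : p ≠ 0 => le_of_mem_indexSet h0 hi
  have hle' := fun h0 : p ≠ 0 => le_of_mem_indexSet h0 hj
  have h2 := two_ne_zero_of_charP (F := F) hp
  rcases hij with rfl | rfl
  -- Both factors are positive and smaller than a nonzero p, so this case cannot occur.
  · have h3 : 2 * (((j + 1 : ℕ) : F) * ((2 * j + 1 : ℕ) : F)) = 0 := by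
      simp only [q] at h
      push_cast at h ⊢
      linear_combination h
    rcases mul_eq_zero.1 ((mul_eq_zero.1 h3).resolve_left h2) with h3 | h3
    · have := eq_zero_or_eq_of_cast_eq_zero (F := F) (p := p) h3 (by omega)
      omega
    · have := eq_zero_or_eq_of_cast_eq_zero (F := F) (p := p) h3 (by omega)
      omega
  -- Here 2i + 3 = p is possible and is the exceptional solution.
  · have h3 : 2 * (((i + 1 : ℕ) : F) * ((2 * i + 3 : ℕ) : F)) = 0 := by
      simp only [q] at h
      push_cast at h ⊢
      linear_combination h
    rcases mul_eq_zero.1 ((mul_eq_zero.1 h3).resolve_left h2) with h3 | h3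
    · have := eq_zero_or_eq_of_cast_eq_zero (F := F) (p := p) h3 (by omega)
      omega
    · have := eq_zero_or_eq_of_cast_eq_zero (F := F) (p := p) h3 (by omega)
      omega

end Eigenvalues

end AffineHeckeClifford

namespace AffineHeckeClifford

/-! ### Weights of modules on which the squares of the `x` act semisimply -/

section Semisimple

variable {F : Type*} [Field F] {n : ℕ} {M : Type*} [AddCommGroup M] [Module F M]
  [Module (AHC F n) M] [IsScalarTower F (AHC F n) M] {p : ℕ} {i : Fin n → ℕ} {z : M}

theorem strandPair {k l : Fin n} (h : k ≠ l) :
    StrandPair (opX F M k) (opX F M l) (opC F M k) (opC F M l) where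
  yx := opX_comm _ _
  cc := opC_opC _
  dd := opC_opC _
  dc := opC_anticomm h.symm
  xc := opX_opC_self _
  yd := opX_opC_self _
  xd := opX_opC h
  yc := opX_opC h.symm

theorem maxGenEigenspace_eq [FiniteDimensional F M] {f : Module.End F M} (hf : f.IsSemisimple)
    (μ : F) : f.maxGenEigenspace μ = f.eigenspace μ :=
  (Module.End.isFinitelySemisimple_iff_isSemisimple.2 hf).maxGenEigenspace_eq_eigenspace μ

theorem swap_mem_weights_of_opPhi_ne_zero (hz : IsEigen (F := F) i z)
    (hi : ∀ k, i k ∈ indexSet p) (k : ℕ) (h : k + 1 < n) (h0 : opPhi F M k h z ≠ 0) :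
    i ∘ Equiv.swap ⟨k, Nat.lt_of_succ_lt h⟩ ⟨k + 1, h⟩ ∈ weights F n M p :=
  (hz.opPhi k h).mem_weights h0 fun _ => hi _

/-- The eigenvalues of a weight with two equal entries at distance two, when neither interchange
of neighbours gives a weight. -/
theorem q_add_three_mul_q_eq_zero (h2 : (2 : F) ≠ 0) (hz : IsEigen (F := F) i z) (h0 : z ≠ 0)
    (k : ℕ) (h : k + 1 + 1 < n) (hk : i ⟨k, by omega⟩ = i ⟨k + 1 + 1, h⟩)
    (hne : q F (i ⟨k, by omega⟩) ≠ q F (i ⟨k + 1, by omega⟩))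
    (h1 : ∀ w : M, IsEigen (F := F) i w → opPhi F M k (Nat.lt_of_succ_lt h) w = 0)
    (h1' : ∀ w : M, IsEigen (F := F) i w → opPhi F M (k + 1) h w = 0) :
    q F (i ⟨k, by omega⟩) = 0 ∨
      q F (i ⟨k, by omega⟩) + 3 * q F (i ⟨k + 1, by omega⟩) = 0 := by
  have hlt : k + 1 < n := by omega
  set A := q F (i ⟨k, by omega⟩) with hA
  set B := q F (i ⟨k + 1, by omega⟩) with hB
  have hA' : A = q F (i ⟨k + 1 + 1, h⟩) := by rw [hA, hk]
  have hk0 : k < n := by omega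
  have hkm : (⟨k, hk0⟩ : Fin n) ≠ ⟨k + 1 + 1, h⟩ := by rw [Ne, Fin.mk.injEq]; omega
  have hd : A - B ≠ 0 := sub_ne_zero.2 hne
  -- A vanishing intertwiner expresses the transposition through the tail. The eigenvalue
  -- differences on the two pairs of strands are opposite, whence opposite signs in `s1` and `s2`.
  have s1 : ∀ w : M, IsEigen (F := F) i w →
      opS F M k hlt w = (-(A - B)⁻¹) • opTail F M k hlt w := by
    intro w hw
    have := h1 w hw
    rw [TwoStrand.intertwiner_of_eigen (hw _) (hw _), add_eq_zero_iff_eq_neg] at this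
    rw [neg_smul, ← smul_neg, ← this, inv_smul_smul₀ hd]
  have s2 : ∀ w : M, IsEigen (F := F) i w →
      opS F M (k + 1) h w = (A - B)⁻¹ • opTail F M (k + 1) h w := by
    intro w hw
    have := h1' w hw
    rw [TwoStrand.intertwiner_of_eigen (hw _) (hw _), ← hA', ← hB, ← neg_sub A B, neg_smul,
      neg_add_eq_zero] at this
    rw [← this, inv_smul_smul₀ hd]
  have hb := opS_braid (F := F) (M := M) k hlt h z
  rw [s1 z hz, s2 z hz, map_smul, map_smul, map_smul, map_smul, s2 _ (hz.opTail k hlt),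
    s1 _ (hz.opTail (k + 1) h), map_smul, map_smul, s1 _ ((hz.opTail k hlt).opTail (k + 1) h),
    s2 _ ((hz.opTail (k + 1) h).opTail k hlt)] at hb
  -- The opposite signs turn the braid relation into the vanishing of a sum of two triple products
  -- of tails, which is a multiple of the tail on the outer strands.
  have ht := (twoStrand (F := F) (M := M) k hlt).tail_braid
    (twoStrand (F := F) (M := M) (k + 1) h).toStrandPair
    (strandPair (k := ⟨k, by omega⟩) (l := ⟨k + 1 + 1, h⟩) hkm) (hz _) (hz _)
    ((hz _).trans (by rw [← hA']))
  have ht' := (strandPair (F := F) (M := M) (k := ⟨k, by omega⟩) (l := ⟨k + 1 + 1, h⟩) hkm).tail_tail (hz _) (hz _)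
  rw [← hA, ← hA', ← two_mul] at ht'
  have h3 : ((A - B)⁻¹) ^ 3 • ((2 * (A + 3 * B)) • tail (opX F M ⟨k, hk0⟩)
      (opX F M ⟨k + 1 + 1, h⟩) (opC F M ⟨k, hk0⟩) (opC F M ⟨k + 1 + 1, h⟩) z) = 0 := by
    rw [← ht]
    linear_combination (norm := module) hb
  rw [smul_eq_zero_iff_right (pow_ne_zero 3 (inv_ne_zero hd)), smul_eq_zero] at h3
  rcases h3 with h3 | h3
  · exact Or.inr ((mul_eq_zero.1 h3).resolve_left h2)
  -- The outer tail squares to `4 * A` on `z`.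
  · rw [h3, map_zero, eq_comm, smul_eq_zero_iff_left h0] at ht'
    exact Or.inl ((mul_eq_zero.1 ((mul_eq_zero.1 ht').resolve_left h2)).resolve_left h2)

variable [FiniteDimensional F M]

theorem exists_isEigen_of_mem_weights (hss : ∀ k : Fin n, (xSq F n M k).IsSemisimple)
    (hi : i ∈ weights F n M p) : ∃ z : M, z ≠ 0 ∧ IsEigen (F := F) i z := by
  obtain ⟨z, hz, h0⟩ := Submodule.exists_mem_ne_zero_of_ne_bot hi.2
  refine ⟨z, h0, isEigen_iff_forall_mem.2 fun k => ?_⟩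
  rw [weightSpace, Submodule.mem_iInf] at hz
  rw [← maxGenEigenspace_eq (hss k)]
  exact hz k

/-- By `s_yy`, x_k² minus its eigenvalue sends `s z` to minus the tail of `z`, which is again an
eigenvector. So `s z` is a generalised eigenvector of order at most two, and semisimplicity makes
the tail vanish. -/
theorem opTail_eq_zero (hss : ∀ k : Fin n, (xSq F n M k).IsSemisimple) (hz : IsEigen (F := F) i z)
    (k : ℕ) (h : k + 1 < n) (hk : i ⟨k, Nat.lt_of_succ_lt h⟩ = i ⟨k + 1, h⟩) :
    opTail F M k h z = 0 := by
  set k' : Fin n := ⟨k, Nat.lt_of_succ_lt h⟩ with hk'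
  have h1 : (xSq F n M k' - q F (i k') • (1 : Module.End F M)) (opS F M k h z) =
      -opTail F M k h z := by
    have := (twoStrand (F := F) k h).s_yy z
    rw [hz, map_smul, ← hk] at this
    simp only [LinearMap.sub_apply, LinearMap.smul_apply, Module.End.one_apply, xSq_apply]
    rw [this]
    abel
  have h2 : opS F M k h z ∈ (xSq F n M k').maxGenEigenspace (q F (i k')) := by
    rw [Module.End.mem_maxGenEigenspace]
    refine ⟨2, ?_⟩
    rw [pow_two, Module.End.mul_apply, h1, map_neg]
    simp [xSq_apply, (hz.opTail k h) k']
  rw [maxGenEigenspace_eq (hss k'), Module.End.mem_eigenspace_iff] at h2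
  simpa [h2] using h1.symm

theorem q_eq_zero_of_eq (h2 : (2 : F) ≠ 0) (hss : ∀ k : Fin n, (xSq F n M k).IsSemisimple)
    (hz : IsEigen (F := F) i z) (h0 : z ≠ 0) (k : ℕ) (h : k + 1 < n)
    (hk : i ⟨k, Nat.lt_of_succ_lt h⟩ = i ⟨k + 1, h⟩) :
    q F (i ⟨k, Nat.lt_of_succ_lt h⟩) = 0 := by
  have h1 := (twoStrand (F := F) k h).tail_tail (hz _) (hz _)
  have h3 := opTail_eq_zero hss hz k h hk
  rw [h3, map_zero, ← hk, eq_comm, smul_eq_zero_iff_left h0, ← two_mul] at h1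
  exact (mul_eq_zero.1 ((mul_eq_zero.1 h1).resolve_left h2)).resolve_left h2

theorem swap_mem_weights [CharP F p] (hp : p ≠ 2)
    (hss : ∀ k : Fin n, (xSq F n M k).IsSemisimple) (hi : i ∈ weights F n M p) (k : ℕ)
    (h : k + 1 < n) (h1 : i ⟨k, Nat.lt_of_succ_lt h⟩ ≠ i ⟨k + 1, h⟩ + 1)
    (h2 : i ⟨k + 1, h⟩ ≠ i ⟨k, Nat.lt_of_succ_lt h⟩ + 1) :
    i ∘ Equiv.swap ⟨k, Nat.lt_of_succ_lt h⟩ ⟨k + 1, h⟩ ∈ weights F n M p := by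
  by_cases hk : i ⟨k, Nat.lt_of_succ_lt h⟩ = i ⟨k + 1, h⟩
  · rwa [Equiv.comp_swap_eq_update, hk, Function.update_eq_self, ← hk, Function.update_eq_self]
  obtain ⟨z, h0, hz⟩ := exists_isEigen_of_mem_weights hss hi
  refine swap_mem_weights_of_opPhi_ne_zero hz hi.1 k h fun h3 => ?_
  have h4 := (twoStrand (F := F) k h).intertwiner_intertwiner (hz _) (hz _)
  rw [h3, map_zero, eq_comm, smul_eq_zero_iff_left h0] at h4
  exact intertwiner_scalar_ne_zero hp (hi.1 _) (hi.1 _) hk h1 h2 h4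

/-- No three consecutive entries of a weight are equal. -/
theorem not_three_eq (h2 : (2 : F) ≠ 0) (hss : ∀ k : Fin n, (xSq F n M k).IsSemisimple)
    (hz : IsEigen (F := F) i z) (h0 : z ≠ 0) (k : ℕ) (h : k + 1 + 1 < n)
    (hk : i ⟨k, by omega⟩ = i ⟨k + 1, by omega⟩) (hk' : i ⟨k + 1, by omega⟩ = i ⟨k + 1 + 1, h⟩) :
    False := by
  have hlt : k + 1 < n := by omega
  have key : ∀ {w : M} (m : ℕ) (hm : m + 1 < n), IsEigen (F := F) i w →
      i ⟨m, Nat.lt_of_succ_lt hm⟩ = i ⟨m + 1, hm⟩ →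
      opX F M ⟨m, Nat.lt_of_succ_lt hm⟩ w = opC F M ⟨m, Nat.lt_of_succ_lt hm⟩
        (opC F M ⟨m + 1, hm⟩ (opX F M ⟨m + 1, hm⟩ w)) := fun m hm hw he =>
    ((twoStrand m hm).tail_eq_zero_iff h2 _).1 (opTail_eq_zero hss hw m hm he)
  have e1 := key k hlt hz hk
  have e2 := key (k + 1) h hz hk'
  -- The vector s_{k+1} z is still an eigenvector, so the tail relation on the first two strands
  -- also holds for it.
  have e3 := key k hlt (hz.opS (k + 1) h hk' (opTail_eq_zero hss hz (k + 1) h hk')) hk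
  have hk0 : k < n := by omega
  have t := twoStrand (F := F) (M := M) (k + 1) h
  have sx := opS_opX (F := F) (M := M) (k + 1) h ⟨k, hk0⟩
    (by dsimp only; omega) (by dsimp only; omega) z
  have sc := opS_opC (F := F) (M := M) (k + 1) h ⟨k, hk0⟩
    (by dsimp only; omega) (by dsimp only; omega)
  have cc := opC_opC (F := F) (M := M) (⟨k, by omega⟩ : Fin n)
  rw [← sx, e1] at e3
  have e4 : opX F M ⟨k + 1, hlt⟩ (opS F M (k + 1) h z) =
      opS F M (k + 1) h (opX F M ⟨k + 1 + 1, h⟩ z) - z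
        + opC F M ⟨k + 1, hlt⟩ (opC F M ⟨k + 1 + 1, h⟩ z) := by
    rw [t.sy]; abel
  rw [e4, e2] at e3
  -- The terms containing s_{k+1} agree on both sides; only Clifford terms survive, so c_{k+1} and
  -- c_{k+2} coincide on `z`, against anticommutation.
  simp only [sc, t.sd, t.cc, map_add, map_sub] at e3
  have e5 : opC F M ⟨k, by omega⟩ (opC F M ⟨k + 1 + 1, h⟩ z) =
      opC F M ⟨k, by omega⟩ (opC F M ⟨k + 1, hlt⟩ z) := by
    linear_combination (norm := module) (-1 : F) • e3
  have e6 : opC F M ⟨k + 1 + 1, h⟩ z = opC F M ⟨k + 1, hlt⟩ z := by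
    rw [← cc (opC F M ⟨k + 1 + 1, h⟩ z), e5, cc]
  have e7 := t.dc z
  rw [e6, t.cc, ← e6, t.dd, eq_neg_iff_add_eq_zero, ← two_smul F] at e7
  exact h0 ((smul_eq_zero_iff_right h2).1 e7)

/-- Equal entries of a weight at distance two. -/
theorem eq_of_eq_at_distance_two [CharP F p] (hp : p ≠ 2)
    (hss : ∀ k : Fin n, (xSq F n M k).IsSemisimple) (hi : i ∈ weights F n M p) (k : ℕ)
    (h : k + 1 + 1 < n) (hk : i ⟨k, by omega⟩ = i ⟨k + 1 + 1, h⟩) :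
    i ⟨k, by omega⟩ = 0 ∨
      (3 ≤ p ∧ i ⟨k, by omega⟩ = (p - 3) / 2 ∧ i ⟨k + 1, by omega⟩ = (p - 1) / 2) := by
  have h2 := two_ne_zero_of_charP (F := F) hp
  have hlt : k + 1 < n := by omega
  have heq : ∀ (j : Fin n → ℕ) (_ : j ∈ weights F n M p) (m : ℕ) (hm : m + 1 < n),
      j ⟨m, Nat.lt_of_succ_lt hm⟩ = j ⟨m + 1, hm⟩ → j ⟨m, Nat.lt_of_succ_lt hm⟩ = 0 := by
    intro j hj m hm he
    obtain ⟨z, h0, hz⟩ := exists_isEigen_of_mem_weights hss hj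
    exact eq_zero_of_q_eq_zero hp (hj.1 _) (q_eq_zero_of_eq h2 hss hz h0 m hm he)
  -- Either interchange would place the two equal entries side by side, so they would be zero.
  have hswap : i ∘ Equiv.swap ⟨k, Nat.lt_of_succ_lt hlt⟩ ⟨k + 1, hlt⟩ ∈ weights F n M p →
      i ⟨k, by omega⟩ = 0 := by
    intro hw
    have e1 : (i ∘ Equiv.swap (⟨k, Nat.lt_of_succ_lt hlt⟩ : Fin n) ⟨k + 1, hlt⟩) ⟨k + 1, hlt⟩ =
        i ⟨k, by omega⟩ := by simp
    have e2 : (i ∘ Equiv.swap (⟨k, Nat.lt_of_succ_lt hlt⟩ : Fin n) ⟨k + 1, hlt⟩) ⟨k + 1 + 1, h⟩ =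
        i ⟨k + 1 + 1, h⟩ := by
      rw [Function.comp_apply, Equiv.swap_apply_of_ne_of_ne] <;> rw [Ne, Fin.mk.injEq] <;> omega
    rw [← e1]
    exact heq _ hw (k + 1) h (by rw [e1, e2, hk])
  have hswap' : i ∘ Equiv.swap ⟨k + 1, hlt⟩ ⟨k + 1 + 1, h⟩ ∈ weights F n M p →
      i ⟨k, by omega⟩ = 0 := by
    intro hw
    have e1 : (i ∘ Equiv.swap (⟨k + 1, hlt⟩ : Fin n) ⟨k + 1 + 1, h⟩) ⟨k + 1, hlt⟩ =
        i ⟨k + 1 + 1, h⟩ := by simp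
    have e2 : (i ∘ Equiv.swap (⟨k + 1, hlt⟩ : Fin n) ⟨k + 1 + 1, h⟩) ⟨k, by omega⟩ =
        i ⟨k, by omega⟩ := by
      rw [Function.comp_apply, Equiv.swap_apply_of_ne_of_ne] <;> rw [Ne, Fin.mk.injEq] <;> omega
    rw [← e2]
    exact heq _ hw k hlt (by rw [e1, e2, hk])
  by_contra hcon
  rw [not_or] at hcon
  obtain ⟨hc1, hc2⟩ := hcon
  have hne : i ⟨k, by omega⟩ ≠ i ⟨k + 1, hlt⟩ := fun he => hc1 (heq i hi k hlt he)
  have hadj : i ⟨k, by omega⟩ = i ⟨k + 1, hlt⟩ + 1 ∨ i ⟨k + 1, hlt⟩ = i ⟨k, by omega⟩ + 1 := by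
    by_contra hcon
    rw [not_or] at hcon
    exact hc1 (hswap (swap_mem_weights hp hss hi k hlt hcon.1 hcon.2))
  obtain ⟨z, h0, hz⟩ := exists_isEigen_of_mem_weights hss hi
  rcases q_add_three_mul_q_eq_zero h2 hz h0 k h hk
      (fun he => hne (q_injOn hp (hi.1 _) (hi.1 _) he))
      (fun w hw => by_contra fun hw0 =>
        hc1 (hswap (swap_mem_weights_of_opPhi_ne_zero hw hi.1 k hlt hw0)))
      (fun w hw => by_contra fun hw0 =>
        hc1 (hswap' (swap_mem_weights_of_opPhi_ne_zero hw hi.1 (k + 1) h hw0))) with h3 | h3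
  · exact hc1 (eq_zero_of_q_eq_zero hp (hi.1 _) h3)
  · exact hc2 (eq_of_q_add_three_mul_q hp (hi.1 _) (hi.1 _) hadj h3)

/-- If the squares of the `x` act semisimply, then the weights satisfy the conditions. -/
theorem weightConditions_of_isSemisimple [CharP F p] (hp : p ≠ 2)
    (hss : ∀ k : Fin n, (xSq F n M k).IsSemisimple) (hi : i ∈ weights F n M p) :
    WeightConditions p (weights F n M p) i := by
  have h2 := two_ne_zero_of_charP (F := F) hp
  obtain ⟨z, h0, hz⟩ := exists_isEigen_of_mem_weights hss hi
  refine ⟨?_, ?_, ?_, ?_, ?_⟩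
  · rintro ⟨k, _⟩ ⟨l, hl⟩ hkl h1 h2
    obtain rfl : l = k + 1 := hkl
    exact swap_mem_weights hp hss hi k hl h1 h2
  · rintro ⟨k, _⟩ ⟨l, hl⟩ hkl h1
    obtain rfl : l = k + 1 := hkl
    have := eq_zero_of_q_eq_zero hp (hi.1 _) (q_eq_zero_of_eq h2 hss hz h0 k hl h1)
    exact ⟨this, h1 ▸ this⟩
  · rintro ⟨⟨k, _⟩, ⟨l, _⟩, ⟨m, hm⟩, hkl, hkm, h1, h3⟩
    obtain rfl : l = k + 1 := hkl
    obtain rfl : m = k + 1 + 1 := hkm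
    exact not_three_eq h2 hss hz h0 k hm h1 h3
  · rintro ⟨k, _⟩ ⟨m, hm⟩ hkm h1 hp0
    obtain rfl : m = k + 1 + 1 := hkm
    rcases eq_of_eq_at_distance_two hp hss hi k hm h1 with h3 | h3
    · exact ⟨h3, h1 ▸ h3⟩
    · omega
  · rintro ⟨k, _⟩ ⟨l, _⟩ ⟨m, hm⟩ hkl hkm h1 hp3
    obtain rfl : l = k + 1 := hkl
    obtain rfl : m = k + 1 + 1 := hkm
    rcases eq_of_eq_at_distance_two hp hss hi k hm h1 with h3 | ⟨_, h3, h4⟩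
    · exact Or.inr ⟨h3, h1 ▸ h3⟩
    · exact Or.inl ⟨h3, h1 ▸ h3, h4⟩

end Semisimple

end AffineHeckeClifford

namespace AffineHeckeClifford

/-! ### The submodule of good vectors -/

section Semisimplicity

/-- An endomorphism is semisimple if its eigenvectors span. -/
theorem isSemisimple_of_span_eigenvectors {F M : Type*} [Field F] [AddCommGroup M] [Module F M]
    [FiniteDimensional F M] (f : Module.End F M) (s : Set M) (hs : Submodule.span F s = ⊤)
    (hf : ∀ z ∈ s, ∃ μ : F, f z = μ • z) : f.IsSemisimple := by
  classical
  set t : Finset F := f.finite_hasEigenvalue.toFinset with ht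
  have hsq : Squarefree (∏ μ ∈ t, (Polynomial.X - Polynomial.C μ)) :=
    (Polynomial.separable_prod_X_sub_C_iff'.2 fun _ _ _ _ h => h).squarefree
  refine Module.End.isSemisimple_of_squarefree_aeval_eq_zero hsq ?_
  refine LinearMap.ext_on hs fun z hz => ?_
  obtain ⟨μ, hμ⟩ := hf z hz
  by_cases h0 : z = 0
  · simp [h0]
  have hv : f.HasEigenvector μ z := ⟨Module.End.mem_eigenspace_iff.2 hμ, h0⟩
  have hmem : μ ∈ t := by
    rw [ht, Set.Finite.mem_toFinset]
    exact Module.End.hasEigenvalue_of_hasEigenvector hv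
  rw [Module.End.aeval_apply_of_hasEigenvector hv, Polynomial.eval_prod, Finset.prod_eq_zero hmem (by simp)]
  simp

/-- Commuting endomorphisms have a common eigenvector. -/
theorem exists_common_eigenvector {F M ι : Type*} [Field F] [IsAlgClosed F] [AddCommGroup M]
    [Module F M] [FiniteDimensional F M] [Nontrivial M] (f : ι → Module.End F M)
    (hf : ∀ k l z, f k (f l z) = f l (f k z)) (t : Finset ι) :
    ∃ (μ : ι → F) (z : M), z ≠ 0 ∧ ∀ k ∈ t, f k z = μ k • z := by
  classical
  induction t using Finset.induction_on with
  | empty =>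
    obtain ⟨z, hz⟩ := exists_ne (0 : M)
    exact ⟨0, z, hz, by simp⟩
  | insert a t ha ih =>
    obtain ⟨μ, z, hz, h⟩ := ih
    let W : Submodule F M := ⨅ k ∈ t, (f k).eigenspace (μ k)
    have hW : ∀ w, w ∈ W ↔ ∀ k ∈ t, f k w = μ k • w := by
      intro w
      simp only [W, Submodule.mem_iInf, Module.End.mem_eigenspace_iff]
    have hmaps : ∀ w ∈ W, f a w ∈ W := by
      intro w hw
      rw [hW] at hw ⊢
      intro k hk
      rw [hf, hw k hk, map_smul]
    have : Nontrivial W := ⟨⟨⟨z, (hW z).2 h⟩, 0, fun h0 => hz (congrArg Subtype.val h0)⟩⟩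
    obtain ⟨ν, hν⟩ := Module.End.exists_eigenvalue ((f a).restrict hmaps)
    obtain ⟨w, hw⟩ := hν.exists_hasEigenvector
    have hw1 : f a w = ν • (w : M) := congrArg Subtype.val hw.apply_eq_smul
    refine ⟨Function.update μ a ν, w, fun h0 => hw.2 (Subtype.ext h0), ?_⟩
    intro k hk
    by_cases hka : k = a
    · subst hka
      rw [Function.update_self, hw1]
    · rw [Function.update_of_ne hka]
      exact (hW w).1 w.2 k ((Finset.mem_insert.1 hk).resolve_left hka)

end Semisimplicity

/-! ### Good vectors and their stability under the generators -/

section Good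

variable {F : Type*} [Field F] {n : ℕ} {M : Type*} [AddCommGroup M] [Module F M]
  [Module (AHC F n) M] [IsScalarTower F (AHC F n) M] {p : ℕ} {i : Fin n → ℕ} {z : M}

/-- A simultaneous eigenvector on which `x a` and `c a * c b * x b` agree for every pair `a < b` of
zero entries. -/
structure IsGood (i : Fin n → ℕ) (z : M) : Prop where
  isEigen : IsEigen (F := F) i z
  pair : ∀ a b : Fin n, a < b → i a = 0 → i b = 0 →
    opX F M a z = opC F M a (opC F M b (opX F M b z))

theorem q_zero : q F 0 = 0 := by simp [q]

theorem IsEigen.opX_opX_eq_zero (hz : IsEigen (F := F) i z) {a : Fin n} (ha : i a = 0) :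
    AffineHeckeClifford.opX F M a (AffineHeckeClifford.opX F M a z) = 0 := by
  rw [hz, ha, q_zero, zero_smul]

/-- For `j` in the pair both sides vanish, because x_a² and x_b² kill `z`; other x_j commute with
the relation. -/
theorem IsGood.opX (hz : IsGood (F := F) i z) (j : Fin n) :
    IsGood (F := F) i (opX F M j z) := by
  refine ⟨hz.isEigen.opX j, fun a b hab ha hb => ?_⟩
  have t := strandPair (F := F) (M := M) hab.ne
  have hp := hz.pair a b hab ha hb
  have haa := hz.isEigen.opX_opX_eq_zero ha
  have hbb := hz.isEigen.opX_opX_eq_zero hb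
  by_cases hja : j = a
  · subst hja
    have e := haa
    rw [hp, t.xc, t.xd, neg_eq_zero] at e
    rw [haa, t.yx, e]
  by_cases hjb : j = b
  · subst hjb
    rw [hbb, map_zero, map_zero, ← t.yx, hp, t.yc, t.yd, hbb]
    simp
  rw [opX_comm a j, opX_comm b j, ← opX_opC hjb, ← opX_opC hja, hp]

theorem IsGood.opC (hz : IsGood (F := F) i z) (j : Fin n) :
    IsGood (F := F) i (opC F M j z) := by
  refine ⟨hz.isEigen.opC j, fun a b hab ha hb => ?_⟩
  have t := strandPair (F := F) (M := M) hab.ne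
  have hp := hz.pair a b hab ha hb
  by_cases hja : j = a
  · subst hja
    rw [t.xc, hp, t.cc, t.yc, t.dc, map_neg, t.cc]
  by_cases hjb : j = b
  · subst hjb
    rw [t.xd, hp, t.yd, t.dc, t.dd, map_neg, t.dd, map_neg]
  rw [opX_opC (Ne.symm hja), opX_opC (Ne.symm hjb), hp, opC_anticomm hja,
    opC_anticomm hjb, map_neg, neg_neg]

/-- The intertwiner preserves good vectors when the two entries are not both zero. -/
theorem IsGood.opPhi (hz : IsGood (F := F) i z) (k : ℕ) (h : k + 1 < n)
    (hk : ¬ (i ⟨k, Nat.lt_of_succ_lt h⟩ = 0 ∧ i ⟨k + 1, h⟩ = 0)) :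
    IsGood (F := F) (i ∘ Equiv.swap ⟨k, Nat.lt_of_succ_lt h⟩ ⟨k + 1, h⟩) (opPhi F M k h z) := by
  refine ⟨hz.isEigen.opPhi k h, fun a b hab ha hb => ?_⟩
  set σ := Equiv.swap (⟨k, Nat.lt_of_succ_lt h⟩ : Fin n) ⟨k + 1, h⟩ with hσ
  have hσσ : ∀ x, σ (σ x) = x := Equiv.swap_apply_self _ _
  have hval : ∀ x : Fin n, (σ x : ℕ) =
      if (x : ℕ) = k then k + 1 else if (x : ℕ) = k + 1 then k else x := by
    intro x
    rw [hσ, Equiv.swap_apply_def]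
    simp only [Fin.ext_iff]
    split_ifs <;> rfl
  -- The transposition reverses the order of no pair except `k`, `k + 1`, and that pair does not
  -- consist of zeros.
  have hne : ¬ ((a : ℕ) = k ∧ (b : ℕ) = k + 1) := by
    rintro ⟨h1, h2⟩
    have h1' : σ a = ⟨k + 1, h⟩ := Fin.ext (by rw [hval, if_pos h1])
    have h2' : σ b = ⟨k, Nat.lt_of_succ_lt h⟩ := Fin.ext (by rw [hval, h2]; simp)
    rw [Function.comp_apply, h1'] at ha
    rw [Function.comp_apply, h2'] at hb
    exact hk ⟨hb, ha⟩
  have hlt : σ a < σ b := by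
    rw [Fin.lt_def, hval, hval]
    rw [Fin.lt_def] at hab
    split_ifs <;> omega
  have hp := congrArg (fun z => AffineHeckeClifford.opPhi F M k h z) (hz.pair _ _ hlt ha hb)
  simpa only [opPhi_opX, opPhi_opC, ← hσ, hσσ] using hp

/-- The transposition of two zero entries preserves good vectors, if there are no other zero
entries. -/
theorem IsGood.opS (hz : IsGood (F := F) i z) (k : ℕ) (h : k + 1 < n)
    (hk : i ⟨k, Nat.lt_of_succ_lt h⟩ = 0) (hl : i ⟨k + 1, h⟩ = 0)
    (ho : ∀ a, i a = 0 → a = ⟨k, Nat.lt_of_succ_lt h⟩ ∨ a = ⟨k + 1, h⟩) :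
    IsGood (F := F) i (opS F M k h z) := by
  have t := twoStrand (F := F) (M := M) k h
  have hp := hz.pair _ _ (by simp [Fin.lt_def]) hk hl
  have ht : opTail F M k h z = 0 := by
    rw [StrandPair.tail_apply, hp]
    simp only [t.dc, t.dd, t.cc, map_neg]
    abel
  refine ⟨hz.isEigen.opS k h (hk.trans hl.symm) ht, fun a b hab ha hb => ?_⟩
  rcases ho a ha with rfl | rfl <;> rcases ho b hb with rfl | rfl
  · exact absurd hab (lt_irrefl _)
  · exact t.x_s_of_tail hp
  · simp [Fin.lt_def] at hab
  · exact absurd hab (lt_irrefl _)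

variable (F M p) in
/-- The span of the good vectors. -/
def goodSpan : Submodule F M :=
  Submodule.span F {z | ∃ i : Fin n → ℕ, (∀ k, i k ∈ indexSet p) ∧ IsGood (F := F) i z}

theorem IsGood.mem_goodSpan (hz : IsGood (F := F) i z) (hi : ∀ k, i k ∈ indexSet p) :
    z ∈ goodSpan F (n := n) M p :=
  Submodule.subset_span ⟨i, hi, hz⟩

/-- At distinct entries the eigenvalues differ, so `s` is a combination of the intertwiner and the
tail, both of which stay in the span. Equal entries are zeros, with no third zero, and `IsGood.opS`
applies. -/
theorem opS_mem_goodSpan [CharP F p] (hp : p ≠ 2)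
    (heq : ∀ i ∈ weights F n M p, ∀ (k : ℕ) (h : k + 1 < n),
      i ⟨k, Nat.lt_of_succ_lt h⟩ = i ⟨k + 1, h⟩ → i ⟨k, Nat.lt_of_succ_lt h⟩ = 0)
    (hthree : ∀ i ∈ weights F n M p, ∀ a b c : Fin n, i a = 0 → i b = 0 → i c = 0 → a ≠ b →
      c = a ∨ c = b)
    (hz : IsGood (F := F) i z) (hi : ∀ k, i k ∈ indexSet p) (k : ℕ) (h : k + 1 < n) :
    opS F M k h z ∈ goodSpan F (n := n) M p := by
  by_cases h0 : z = 0
  · rw [h0, map_zero]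
    exact Submodule.zero_mem _
  have hw := hz.isEigen.mem_weights h0 hi
  by_cases hk : i ⟨k, Nat.lt_of_succ_lt h⟩ = i ⟨k + 1, h⟩
  · have hk0 := heq i hw k h hk
    refine (hz.opS k h hk0 (hk ▸ hk0) fun a ha => ?_).mem_goodSpan hi
    exact hthree i hw _ _ a hk0 (hk ▸ hk0) ha (by simp)
  · have h1 := TwoStrand.intertwiner_of_eigen (S := opS F M k h)
      (C := opC F M ⟨k, Nat.lt_of_succ_lt h⟩) (D := opC F M ⟨k + 1, h⟩)
      (hz.isEigen ⟨k, Nat.lt_of_succ_lt h⟩) (hz.isEigen ⟨k + 1, h⟩)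
    have hd : q F (i ⟨k, Nat.lt_of_succ_lt h⟩) - q F (i ⟨k + 1, h⟩) ≠ 0 :=
      sub_ne_zero.2 fun he => hk (q_injOn hp (hi _) (hi _) he)
    rw [← sub_eq_iff_eq_add] at h1
    rw [← inv_smul_smul₀ hd (opS F M k h z), ← h1]
    refine Submodule.smul_mem _ _ (Submodule.sub_mem _ ?_ ?_)
    · exact (hz.opPhi k h fun h2 => hk (h2.1.trans h2.2.symm)).mem_goodSpan fun _ => hi _
    · rw [StrandPair.tail_apply]
      exact Submodule.sub_mem _ (Submodule.add_mem _ (Submodule.add_mem _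
        ((hz.opX _).mem_goodSpan hi) ((hz.opX _).mem_goodSpan hi))
        ((((hz.opX _).opC _).opC _).mem_goodSpan hi)) ((((hz.opX _).opC _).opC _).mem_goodSpan hi)

theorem opGen_mem_goodSpan [CharP F p] (hp : p ≠ 2)
    (heq : ∀ i ∈ weights F n M p, ∀ (k : ℕ) (h : k + 1 < n),
      i ⟨k, Nat.lt_of_succ_lt h⟩ = i ⟨k + 1, h⟩ → i ⟨k, Nat.lt_of_succ_lt h⟩ = 0)
    (hthree : ∀ i ∈ weights F n M p, ∀ a b c : Fin n, i a = 0 → i b = 0 → i c = 0 → a ≠ b →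
      c = a ∨ c = b)
    (g : Gen n) : ∀ z ∈ goodSpan F (n := n) M p, opGen F M g z ∈ goodSpan F (n := n) M p := by
  intro z hz
  induction hz using Submodule.span_induction with
  | mem z hz =>
    obtain ⟨i, hi, hz⟩ := hz
    cases g with
    | s k h => exact opS_mem_goodSpan hp heq hthree hz hi k h
    | x k => exact (hz.opX k).mem_goodSpan hi
    | c k => exact (hz.opC k).mem_goodSpan hi
  | zero => rw [map_zero]; exact Submodule.zero_mem _
  | add x y _ _ hx hy => rw [map_add]; exact Submodule.add_mem _ hx hy
  | smul r x _ hx => rw [map_smul]; exact Submodule.smul_mem _ _ hx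

/-! ### Compatibility with the grading -/

omit [IsScalarTower F (AHC F n) M] in
/-- Even elements commute with the projections to the homogeneous components. -/
theorem decompose_even_smul (ℳ : ZMod 2 → Submodule F M) [DirectSum.Decomposition ℳ]
    [SetLike.GradedSMul (grading F n) ℳ] {a : AHC F n} (ha : a ∈ grading F n 0) (e : ZMod 2)
    (z : M) : (DirectSum.decompose ℳ (a • z) e : M) = a • (DirectSum.decompose ℳ z e : M) := by
  induction z using DirectSum.Decomposition.inductionOn ℳ with
  | zero => simp
  | @homogeneous j m =>
    have hm : a • (m : M) ∈ ℳ j := by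
      have := SetLike.GradedSMul.smul_mem (B := ℳ) ha m.2
      rwa [vadd_eq_add, zero_add] at this
    by_cases hj : j = e
    · subst hj
      rw [DirectSum.decompose_of_mem_same ℳ hm, DirectSum.decompose_of_mem_same ℳ m.2]
    · rw [DirectSum.decompose_of_mem_ne ℳ hm hj, DirectSum.decompose_of_mem_ne ℳ m.2 hj, smul_zero]
  | add x y hx hy =>
    rw [smul_add, DirectSum.decompose_add, DirectSum.decompose_add, DirectSum.add_apply,
      DirectSum.add_apply, Submodule.coe_add, Submodule.coe_add, hx, hy, smul_add]

/-- Goodness is expressed by the even elements x_k², x_a and c_a c_b x_b, so it passes to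
homogeneous components. -/
theorem IsGood.decompose (ℳ : ZMod 2 → Submodule F M) [DirectSum.Decomposition ℳ]
    [SetLike.GradedSMul (grading F n) ℳ] (hz : IsGood (F := F) i z) (e : ZMod 2) :
    IsGood (F := F) i (DirectSum.decompose ℳ z e : M) := by
  have hx : ∀ a : Fin n, gen F n (Gen.x a) ∈ grading F n 0 := fun a => gen_mem_grading F (Gen.x a)
  have hc : ∀ a : Fin n, gen F n (Gen.c a) ∈ grading F n 1 := fun a => gen_mem_grading F (Gen.c a)
  have hxx : ∀ a : Fin n, gen F n (Gen.x a) * gen F n (Gen.x a) ∈ grading F n 0 := fun a => by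
    rw [← add_zero (0 : ZMod 2)]
    exact SetLike.mul_mem_graded (hx a) (hx a)
  have hccx : ∀ a b : Fin n, gen F n (Gen.c a) * (gen F n (Gen.c b) * gen F n (Gen.x b)) ∈ grading F n 0 :=
    fun a b => by
      rw [show (0 : ZMod 2) = 1 + (1 + 0) by decide]
      exact SetLike.mul_mem_graded (hc a) (SetLike.mul_mem_graded (hc b) (hx b))
  refine ⟨fun k => ?_, fun a b hab ha hb => ?_⟩
  · have h1 := decompose_even_smul ℳ (hxx k) e z
    simp only [mul_smul, ← opX_apply] at h1
    rw [← h1, hz.isEigen k, DirectSum.decompose_smul,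
      DirectSum.smul_apply, Submodule.coe_smul]
  · have h1 := decompose_even_smul ℳ (hx a) e z
    have h2 := decompose_even_smul ℳ (hccx a b) e z
    simp only [mul_smul, ← opX_apply, ← opC_apply] at h1 h2
    rw [← h1, ← h2, ← hz.pair a b hab ha hb]

theorem decompose_mem_goodSpan (ℳ : ZMod 2 → Submodule F M) [DirectSum.Decomposition ℳ]
    [SetLike.GradedSMul (grading F n) ℳ] (e : ZMod 2) :
    ∀ z ∈ goodSpan F (n := n) M p, (DirectSum.decompose ℳ z e : M) ∈ goodSpan F (n := n) M p := by
  intro z hz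
  induction hz using Submodule.span_induction with
  | mem z hz =>
    obtain ⟨i, hi, hz⟩ := hz
    exact (hz.decompose ℳ e).mem_goodSpan hi
  | zero => simp
  | add x y _ _ hx hy =>
    rw [DirectSum.decompose_add]
    exact Submodule.add_mem _ hx hy
  | smul r x _ hx =>
    rw [DirectSum.decompose_smul]
    exact Submodule.smul_mem _ _ hx

/-! ### Existence of good vectors and use of irreducibility -/

/-- Integral modules have nonzero simultaneous eigenvectors. -/
theorem exists_isEigen [IsAlgClosed F] [FiniteDimensional F M] [Nontrivial M]
    (hint : IsIntegral F n M p) :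
    ∃ (i : Fin n → ℕ) (z : M), (∀ k, i k ∈ indexSet p) ∧ z ≠ 0 ∧ IsEigen (F := F) i z := by
  obtain ⟨μ, z, h0, hz⟩ := exists_common_eigenvector (fun k => xSq F n M k)
    (fun k l z => by simp only [xSq_apply, opX_comm k l]) Finset.univ
  have h1 : ∀ k, ∃ i ∈ indexSet p, μ k = q F i := fun k =>
    hint k (μ k) (Module.End.hasEigenvalue_of_hasEigenvector
      ⟨Module.End.mem_eigenspace_iff.2 (hz k (Finset.mem_univ k)), h0⟩)
  choose i hi hμ using h1
  exact ⟨i, z, hi, h0, fun k => by rw [← xSq_apply, hz k (Finset.mem_univ k), hμ]⟩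

/-- Integral modules whose weights have at most two zero entries have nonzero good vectors. -/
theorem goodSpan_ne_bot [IsAlgClosed F] [FiniteDimensional F M] [Nontrivial M]
    (h2 : (2 : F) ≠ 0) (hint : IsIntegral F n M p)
    (hthree : ∀ i ∈ weights F n M p, ∀ a b c : Fin n, i a = 0 → i b = 0 → i c = 0 → a ≠ b →
      c = a ∨ c = b) :
    goodSpan F (n := n) M p ≠ ⊥ := by
  obtain ⟨i, z, hi, h0, hz⟩ := exists_isEigen hint
  suffices h : ∃ w : M, w ≠ 0 ∧ IsGood (F := F) i w by
    obtain ⟨w, hw0, hw⟩ := h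
    exact fun hbot => hw0 ((Submodule.mem_bot F).1 (hbot ▸ hw.mem_goodSpan hi))
  by_cases hpair : ∃ a b : Fin n, a < b ∧ i a = 0 ∧ i b = 0
  · obtain ⟨a, b, hab, ha, hb⟩ := hpair
    have t := strandPair (F := F) (M := M) hab.ne
    have hgood : ∀ w : M, IsEigen (F := F) i w →
        tail (opX F M a) (opX F M b) (opC F M a) (opC F M b) w = 0 → IsGood (F := F) i w := by
      refine fun w hw ht => ⟨hw, fun a' b' hab' ha' hb' => ?_⟩
      have e1 := hthree i (hz.mem_weights h0 hi) a b a' ha hb ha' hab.ne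
      have e2 := hthree i (hz.mem_weights h0 hi) a b b' ha hb hb' hab.ne
      rcases e1 with rfl | rfl <;> rcases e2 with rfl | rfl
      · exact absurd hab' (lt_irrefl _)
      · exact (t.tail_eq_zero_iff h2 w).1 ht
      · exact absurd hab' hab.asymm
      · exact absurd hab' (lt_irrefl _)
    -- On eigenvalues zero the tail squares to zero, so it kills `z` or its nonzero image of `z`.
    by_cases ht : tail (opX F M a) (opX F M b) (opC F M a) (opC F M b) z = 0
    · exact ⟨z, h0, hgood z hz ht⟩
    · refine ⟨_, ht, hgood _ ?_ ?_⟩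
      · rw [StrandPair.tail_apply]
        exact (((hz.opX _).add (hz.opX _)).add (((hz.opX _).opC _).opC _)).sub
          (((hz.opX _).opC _).opC _)
      · rw [t.tail_tail (hz a) (hz b), ha, hb, q_zero]
        simp
  · exact ⟨z, h0, hz, fun a b hab ha hb => absurd ⟨a, b, hab, ha, hb⟩ hpair⟩

/-- An irreducible integral module is spanned by good vectors, if equal neighbours in a weight are
zero and no weight has three zero entries. -/
theorem goodSpan_eq_top [IsAlgClosed F] [CharP F p] (hp : p ≠ 2) [FiniteDimensional F M]
    (ℳ : ZMod 2 → Submodule F M) [DirectSum.Decomposition ℳ]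
    [SetLike.GradedSMul (grading F n) ℳ] (hint : IsIntegral F n M p)
    (hirr : IsIrreducible F n M ℳ)
    (heq : ∀ i ∈ weights F n M p, ∀ (k : ℕ) (h : k + 1 < n),
      i ⟨k, Nat.lt_of_succ_lt h⟩ = i ⟨k + 1, h⟩ → i ⟨k, Nat.lt_of_succ_lt h⟩ = 0)
    (hthree : ∀ i ∈ weights F n M p, ∀ a b c : Fin n, i a = 0 → i b = 0 → i c = 0 → a ≠ b →
      c = a ∨ c = b) :
    goodSpan F (n := n) M p = ⊤ := by
  have := hirr.1
  let N : Submodule (AHC F n) M :=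
    { (goodSpan F (n := n) M p).toAddSubmonoid with
      smul_mem' := fun a z hz =>
        smul_mem_of_generators _ (opGen_mem_goodSpan hp heq hthree) a z hz }
  have hN : ∀ z, z ∈ N ↔ z ∈ goodSpan F (n := n) M p := fun _ => Iff.rfl
  rcases hirr.2 N (fun e z hz => decompose_mem_goodSpan ℳ e z hz) with h | h
  · refine absurd ?_ (goodSpan_ne_bot (two_ne_zero_of_charP (F := F) hp) hint hthree)
    rw [Submodule.eq_bot_iff]
    intro z hz
    rwa [← hN, h, Submodule.mem_bot] at hz
  · rw [Submodule.eq_top_iff']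
    intro z
    rw [← hN, h]
    exact Submodule.mem_top

theorem isSemisimple_of_goodSpan_eq_top [FiniteDimensional F M]
    (h : goodSpan F (n := n) M p = ⊤) (k : Fin n) : (xSq F n M k).IsSemisimple := by
  refine isSemisimple_of_span_eigenvectors _ _ h ?_
  rintro z ⟨i, -, hz⟩
  exact ⟨q F (i k), by rw [xSq_apply, hz.isEigen k]⟩

end Good

end AffineHeckeClifford

theorem mainTheorem12 {F : Type*} [Field F] [IsAlgClosed F] (p : ℕ) [CharP F p] (hp : p ≠ 2)
    (n : ℕ) (hn : n = 2 ∨ n = 3)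
    {M : Type*} [AddCommGroup M] [Module F M] [FiniteDimensional F M]
    [Module (AffineHeckeClifford.AHC F n) M] [IsScalarTower F (AffineHeckeClifford.AHC F n) M]
    (ℳ : ZMod 2 → Submodule F M) [DirectSum.Decomposition ℳ]
    [SetLike.GradedSMul (AffineHeckeClifford.grading F n) ℳ]
    (hint : AffineHeckeClifford.IsIntegral F n M p)
    (hirr : AffineHeckeClifford.IsIrreducible F n M ℳ) :
    (∀ k : Fin n, (AffineHeckeClifford.xSq F n M k).IsSemisimple) ↔
      ∀ i ∈ AffineHeckeClifford.weights F n M p,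
        AffineHeckeClifford.WeightConditions p (AffineHeckeClifford.weights F n M p) i := by
  refine ⟨fun hss i hi => AffineHeckeClifford.weightConditions_of_isSemisimple hp hss hi,
    fun hcond => AffineHeckeClifford.isSemisimple_of_goodSpan_eq_top
      (AffineHeckeClifford.goodSpan_eq_top hp ℳ hint hirr ?_ ?_)⟩
  · intro i hi k h hk
    exact ((hcond i hi).eq_zero _ _ rfl hk).1
  · intro i hi a b c ha hb hc hab
    by_contra hcon
    rw [not_or] at hcon
    -- Three distinct positions do not exist for n = 2; for n = 3 they are all positions, hence
    -- consecutive, and condition 3 excludes three zeros.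
    rcases hn with rfl | rfl
    · omega
    · have hall : ∀ d : Fin 3, i d = 0 := by
        intro d
        have hd : d = a ∨ d = b ∨ d = c := by omega
        rcases hd with rfl | rfl | rfl <;> assumption
      exact (hcond i hi).not_three ⟨0, 1, 2, rfl, rfl, by rw [hall, hall], by rw [hall, hall]⟩
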